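/- Let $E$ and $V$ be real vector spaces (of arbitrary dimension), let $m\ge 2$ be an integer, and let $\Delta_m\subseteq E$ be an $m$-dimensional simplex, i.e. the convex hull of $m+1$ affinely independent points. Let $f:\Delta_m\to V$ be one-to-one and monotone, where monotone means that it preserves betweenness: for all $a,x,b\in\Delta_m$, if $x$ lies in the segment $[a,b]$, then $f(x)$ lies in the segment $[f(a),f(b)]$. Then $f(\Delta_m)$ is an $m$-dimensional simplex, and $f$ is a partial homography, in the following sense. Let $A$ and $B$ be the affine hulls of $\Delta_m$ and $f(\Delta_m)$, and let $\hat A$, $\hat B$ be their projective completions: $\hat A$ is the projective space of the linear subspace of $E\times\mathbb R$ spanned by $\{(x,1):x\in A\}$, a point $x\in A$ being identified with $[x:1]\in\hat A$, and similarly $\hat B$ in $V\times\mathbb R$. Then there is a homography $g:\hat A\to\hat B$ that extends $f$, i.e. $g([x:1])=[f(x):1]$ for all $x\in\Delta_m$. Here a homography is a bijection $g:\hat A\to\hat B$ that maps projective lines onto projective lines and that is a projective transformation, i.e. there are an affine map $T:E\to V$ and an affine functional $d:E\to\mathbb R$ (so $d(x)=\alpha+\varphi(x)$ with $\alpha\in\mathbb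 R$ and $\varphi$ linear) with $g([x:1])=[T(x):d(x)]$ for all $x\in A$; thus $g$ is $x\mapsto \frac{1}{d(x)}T(x)$ at the points $x\in A$ with $d(x)\neq 0$. In particular, $d(x)\ne 0$ and $f(x)=\frac{1}{d(x)}T(x)$ for all $x\in\Delta_m$. -/

import Mathlib

open scoped LinearAlgebra.Projectivization

/-- A mapping `f : S → V`, defined on a subset `S` of a real vector space, is monotone if it preserves
the euclidean betweenness: whenever `x` lies on the segment joining `a` and `b` (all three in `S`),
`f x` lies on the segment joining `f a` and `f b`. -/
def IsMonotoneMap {E V : Type*} [AddCommGroup E] [Module ℝ E] [AddCommGroup V] [Module ℝ V]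
    {S : Set E} (f : S → V) : Prop :=
  ∀ a x b : S, Wbtw ℝ (a : E) (x : E) (b : E) → Wbtw ℝ (f a) (f x) (f b)

/-- `S` is an `m`-dimensional simplex: the convex hull of `m + 1` affinely independent points. -/
def IsSimplex {E : Type*} [AddCommGroup E] [Module ℝ E] (m : ℕ) (S : Set E) : Prop :=
  ∃ p : Fin (m + 1) → E, AffineIndependent ℝ p ∧ S = convexHull ℝ (Set.range p)

/-- The linear subspace of `E × ℝ` spanned by the vectors `(x, 1)` with `x ∈ A`. -/
def homogenization {E : Type*} [AddCommGroup E] [Module ℝ E] (A : AffineSubspace ℝ E) :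
    Submodule ℝ (E × ℝ) :=
  Submodule.span ℝ ((fun x : E => (x, (1 : ℝ))) '' (A : Set E))

/-- The projective completion of the affine space `A`: the points of `A`, together with one point at
infinity for each direction of `A`. -/
abbrev ProjectiveCompletion {E : Type*} [AddCommGroup E] [Module ℝ E] (A : AffineSubspace ℝ E) :
    Type _ :=
  ℙ ℝ (homogenization A)

/-- A point `x` of `A`, as the point `[x : 1]` of the projective completion of `A`. -/
noncomputable def toProjective {E : Type*} [AddCommGroup E] [Module ℝ E] (A : AffineSubspace ℝ E)
    (x : E) (hx : x ∈ A) : ProjectiveCompletion A :=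
  Projectivization.mk ℝ
    (⟨(x, 1), Submodule.subset_span ⟨x, hx, rfl⟩⟩ : homogenization A)
    (fun h => one_ne_zero (congrArg (fun w : homogenization A => (w : E × ℝ).2) h))

/-- A set of points of a projective space is a line if it consists of the points that lie in some
two-dimensional linear subspace. -/
def IsProjectiveLine {U : Type*} [AddCommGroup U] [Module ℝ U] (l : Set (ℙ ℝ U)) : Prop :=
  ∃ M : Submodule ℝ U, Module.finrank ℝ M = 2 ∧ l = {q : ℙ ℝ U | q.submodule ≤ M}

/-- A map between the projective completions of `A` and `B` is a projective transformation if
there are an affine `T` and an affine functional `d` (that is, `d x = α + φ x` with `φ` linear)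
such that `x ∈ A` is sent to the point `[T x : d x]`. So `x` is sent to the affine point
`(1 / d x) • T x` if `d x ≠ 0`, and to the point at infinity in direction `T x` if `d x = 0`. -/
def IsProjectiveTransformation {E V : Type*} [AddCommGroup E] [Module ℝ E]
    [AddCommGroup V] [Module ℝ V] {A : AffineSubspace ℝ E} {B : AffineSubspace ℝ V}
    (g : ProjectiveCompletion A → ProjectiveCompletion B) : Prop :=
  ∃ (T : E →ᵃ[ℝ] V) (d : E →ᵃ[ℝ] ℝ), ∀ (x : E) (hx : x ∈ A),
    (g (toProjective A x hx)).submodule.map (homogenization B).subtype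
      = Submodule.span ℝ {(T x, d x)}

/-- A homography is an isomorphism of real projective spaces: a bijective projective transformation
mapping lines onto lines. -/
def IsHomography {E V : Type*} [AddCommGroup E] [Module ℝ E]
    [AddCommGroup V] [Module ℝ V] {A : AffineSubspace ℝ E} {B : AffineSubspace ℝ V}
    (g : ProjectiveCompletion A → ProjectiveCompletion B) : Prop :=
  Function.Bijective g ∧ (∀ l, IsProjectiveLine l → IsProjectiveLine (g '' l)) ∧
    IsProjectiveTransformation g

/-- `f : S → V` is a partial homography if some homography, from the projective completion of the
affine hull of `S` onto the projective completion of the affine hull of `f(S)`, extends `f`. -/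
def IsPartialHomography {E V : Type*} [AddCommGroup E] [Module ℝ E] [AddCommGroup V] [Module ℝ V]
    {S : Set E} (f : S → V) : Prop :=
  ∃ g : ProjectiveCompletion (affineSpan ℝ S) →
      ProjectiveCompletion (affineSpan ℝ (Set.range f)),
    IsHomography g ∧
    ∀ x : S, g (toProjective _ (x : E) (subset_affineSpan ℝ S x.2)) =
      toProjective _ (f x) (subset_affineSpan ℝ (Set.range f) (Set.mem_range_self x))

/-! In barycentric coordinates `f` becomes a map on a standard simplex. Two facts are needed: the
images of the vertices are affinely independent, and a betweenness preserving map with that property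
is determined by its values at the vertices and at the barycenter.

Rigidity. Betweenness sends every face into the hull of the images of its vertices. Read in the
barycentric coordinates of the image vertices, `f` is thus a self-map of the simplex fixing the
vertices. By injectivity the barycenter goes to a point `c` with positive coordinates, and dividing
the coordinates by `c` and renormalizing is a projective map that preserves betweenness, fixes the
vertices and returns `c` to the barycenter. The composite is the identity
(`PreservesBetweennessOn.map_eq_self`): it fixes the midpoints of the edges, hence by repeated
subdivision every triangle of vertices, and then every point by induction on its support. So `f` is
projective with weights `c` (`PreservesBetweennessOn.exists_weights`), and in homogeneous
coordinates it is linear.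

Nondegeneracy. A triangle admits no injective betweenness preserving real function: on each side, a
point where the function is continuous along the side would have a value extremal against everything
off that side, and two of the three sides would be extremal in the same direction. Hence triangles
do not collapse. In higher dimension, if the image vertices were dependent, a Radon point would lie
in the hulls of two complementary sets of them; by induction `f` maps each proper face onto the hull
of its image vertices, so this point would be the image of two points with disjoint supports. -/

/-- `f` preserves the betweenness of points of `C`. -/
def PreservesBetweennessOn {E V : Type*} [AddCommGroup E] [Module ℝ E] [AddCommGroup V] [Module ℝ V]
    (f : E → V) (C : Set E) : Prop :=
  ∀ a ∈ C, ∀ x ∈ C, ∀ b ∈ C, Wbtw ℝ a x b → Wbtw ℝ (f a) (f x) (f b)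

theorem wbtw_iff_exists_eq_add {E : Type*} [AddCommGroup E] [Module ℝ E] {a x b : E} :
    Wbtw ℝ a x b ↔ ∃ s t : ℝ, 0 ≤ s ∧ 0 ≤ t ∧ s + t = 1 ∧ x = s • a + t • b := by
  rw [← mem_segment_iff_wbtw, segment]
  simp [eq_comm]

theorem Real.le_of_wbtw {a x b : ℝ} (h : Wbtw ℝ a x b) :
    (a ≤ x ∧ x ≤ b) ∨ (b ≤ x ∧ x ≤ a) := by
  rcases le_total a b with hab | hab
  · exact .inl ((wbtw_iff_of_le hab).1 h)
  · exact .inr ((wbtw_iff_of_le hab).1 h.symm)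

/-! ### Real-valued betweenness preserving functions: thresholds and continuity -/

section RealValued

variable {E : Type*} [AddCommGroup E] [Module ℝ E]

theorem PreservesBetweennessOn.neg {F : E → ℝ} {C : Set E} (hF : PreservesBetweennessOn F C) :
    PreservesBetweennessOn (fun x => -F x) C := by
  intro a ha x hx b hb h
  obtain ⟨s, t, hs, ht, hst, e⟩ := wbtw_iff_exists_eq_add.1 (hF a ha x hx b hb h)
  refine wbtw_iff_exists_eq_add.2 ⟨s, t, hs, ht, hst, ?_⟩
  simp only [smul_eq_mul] at e ⊢
  rw [e]; ring

/-- A downward closed condition on `[0, 1]` that holds at `0` has a threshold. -/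
theorem exists_threshold {P : ℝ → Prop} (h0 : P 0)
    (hP : ∀ s t, 0 ≤ s → s ≤ t → t ≤ 1 → P t → P s) :
    ∃ c, 0 ≤ c ∧ c ≤ 1 ∧ (∀ s, 0 ≤ s → s < c → P s) ∧ (∀ s, c < s → s ≤ 1 → ¬ P s) := by
  set S : Set ℝ := {s | 0 ≤ s ∧ s ≤ 1 ∧ P s} with hS
  have hne : S.Nonempty := ⟨0, le_rfl, zero_le_one, h0⟩
  have hbdd : BddAbove S := ⟨1, fun s hs => hs.2.1⟩
  refine ⟨sSup S, le_csSup hbdd ⟨le_rfl, zero_le_one, h0⟩, csSup_le hne fun s hs => hs.2.1, ?_, ?_⟩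
  · intro s hs hlt
    obtain ⟨t, ht, hst⟩ := exists_lt_of_lt_csSup hne hlt
    exact hP s t hs hst.le ht.2.1 ht.2.2
  · intro s hlt hs h
    have h0s : 0 ≤ s := (le_csSup hbdd ⟨le_rfl, zero_le_one, h0⟩).trans hlt.le
    exact absurd (le_csSup hbdd ⟨h0s, hs, h⟩) (not_le.2 hlt)

/-- A betweenness preserving function that is continuous at `o` in the direction `u` takes values
on the same side of its value at `o` along two rays that differ by a multiple of `u`. -/
theorem PreservesBetweennessOn.false_of_lt_of_lt {F : E → ℝ} {C : Set E}
    (hF : PreservesBetweennessOn F C) (hC : Convex ℝ C) {o u p : E} (ho : o ∈ C)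
    (hp : o + (2 : ℝ) • p ∈ C) (hq : o + (2 : ℝ) • (p + u) ∈ C)
    (hcont : ∀ ε > 0, ∃ η > 0, ∀ s : ℝ, |s| ≤ η → o + s • u ∈ C ∧ |F (o + s • u) - F o| < ε)
    (hne : ∀ s : ℝ, 0 ≤ s → s ≤ 1 → F (o + (p + s • u)) ≠ F o)
    (h0 : F o < F (o + p)) (h1 : F (o + (p + u)) < F o) : False := by
  have hC2 : ∀ s : ℝ, 0 ≤ s → s ≤ 1 → o + (2 : ℝ) • (p + s • u) ∈ C := by
    intro s hs hs1
    convert hC hp hq (sub_nonneg.2 hs1) hs (by ring) using 1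
    module
  have hC1 : ∀ s : ℝ, 0 ≤ s → s ≤ 1 → o + (p + s • u) ∈ C := by
    intro s hs hs1
    convert hC ho (hC2 s hs hs1) (by norm_num : (0 : ℝ) ≤ 1 / 2) (by norm_num : (0 : ℝ) ≤ 1 / 2)
      (by norm_num) using 1
    module
  have hmid : ∀ s : ℝ, 0 ≤ s → s ≤ 1 →
      Wbtw ℝ (F o) (F (o + (p + s • u))) (F (o + (2 : ℝ) • (p + s • u))) := by
    intro s hs hs1
    refine hF _ ho _ (hC1 s hs hs1) _ (hC2 s hs hs1) (wbtw_iff_exists_eq_add.2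
      ⟨1 / 2, 1 / 2, by norm_num, by norm_num, by norm_num, by module⟩)
  -- Betweenness along the segment from `o + p` makes the condition downward closed, because it
  -- already holds at `s = 0`.
  obtain ⟨c, hc0, hc1, hlt, hgt⟩ := exists_threshold (P := fun s => F o < F (o + (p + s • u)))
    (by simpa using h0) (by
      intro s t hs hst ht h
      rcases hs.eq_or_lt with rfl | hs
      · simpa using h0
      have ht0 : 0 < t := hs.trans_le hst
      have hw : Wbtw ℝ (o + (p + (0 : ℝ) • u)) (o + (p + s • u)) (o + (p + t • u)) := by
        refine wbtw_iff_exists_eq_add.2 ⟨1 - s / t, s / t, sub_nonneg.2 ((div_le_one ht0).2 hst),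
          by positivity, by ring, ?_⟩
        match_scalars <;> field_simp <;> ring
      have hw' := Real.le_of_wbtw (hF _ (hC1 0 le_rfl zero_le_one) _ (hC1 s hs.le (hst.trans ht)) _
        (hC1 t ht0.le ht) hw)
      simp only [zero_smul, add_zero] at hw'
      rcases hw' with hw' | hw' <;> linarith)
  have hcC := hC1 c hc0 hc1
  -- If the value at `c` is below `F o`, the point `o + (p + c • u)` is the midpoint of `o + (2 * ε)
  -- • u` and `o + 2 • (p + (c - ε) • u)`. The first has value near `F o` by continuity, the second
  -- a value above `F o` by betweenness along its ray, so the midpoint cannot have a smaller value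
  -- than both. The other case is symmetric, with `c + ε` and `-(2 * ε)`.
  rcases (hne c hc0 hc1).lt_or_gt with hw | hw
  · have hcpos : 0 < c := by
      rcases hc0.eq_or_lt with rfl | h
      · simp only [zero_smul, add_zero] at hw; linarith
      · exact h
    obtain ⟨η, hη, hη'⟩ := hcont _ (sub_pos.2 hw)
    set ε := min c (η / 2) with hε
    have hε0 : 0 < ε := lt_min hcpos (by positivity)
    have hεc : ε ≤ c := min_le_left _ _
    have hεη : ε ≤ η / 2 := min_le_right _ _
    obtain ⟨hsC, hsF⟩ := hη' (2 * ε) (by rw [abs_of_pos (by positivity)]; linarith)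
    have h2 := Real.le_of_wbtw (hF _ hsC _ hcC _ (hC2 (c - ε) (by linarith) (by linarith))
      (wbtw_iff_exists_eq_add.2
        ⟨1 / 2, 1 / 2, by norm_num, by norm_num, by norm_num, by module⟩))
    have h3 := Real.le_of_wbtw (hmid (c - ε) (by linarith) (by linarith))
    have h4 := hlt (c - ε) (by linarith) (by linarith)
    have h5 := abs_lt.1 hsF
    rcases h2 with h2 | h2 <;> rcases h3 with h3 | h3 <;> linarith
  · have hclt : c < 1 := by
      rcases hc1.eq_or_lt with rfl | h
      · simp only [one_smul] at hw; linarith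
      · exact h
    obtain ⟨η, hη, hη'⟩ := hcont _ (sub_pos.2 hw)
    set ε := min (1 - c) (η / 2) with hε
    have hε0 : 0 < ε := lt_min (by linarith) (by positivity)
    have hεc : ε ≤ 1 - c := min_le_left _ _
    have hεη : ε ≤ η / 2 := min_le_right _ _
    obtain ⟨hsC, hsF⟩ := hη' (-(2 * ε)) (by rw [abs_neg, abs_of_pos (by positivity)]; linarith)
    have h2 := Real.le_of_wbtw (hF _ hsC _ hcC _ (hC2 (c + ε) (by linarith) (by linarith))
      (wbtw_iff_exists_eq_add.2
        ⟨1 / 2, 1 / 2, by norm_num, by norm_num, by norm_num, by module⟩))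
    have h3 := Real.le_of_wbtw (hmid (c + ε) (by linarith) (by linarith))
    have h4 := hgt (c + ε) (by linarith) (by linarith)
    have h4' := (hne (c + ε) (by linarith) (by linarith)).lt_of_le (not_lt.1 h4)
    have h5 := abs_lt.1 hsF
    rcases h2 with h2 | h2 <;> rcases h3 with h3 | h3 <;> linarith

/-- A betweenness preserving function on a segment is continuous at some inner point. -/
theorem exists_continuousAt_of_preservesBetweenness {h : ℝ → ℝ}
    (hh : PreservesBetweennessOn h (Set.Icc 0 1)) :
    ∃ τ ∈ Set.Ioo (0 : ℝ) 1, ContinuousAt h τ := by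
  have key : ∀ h : ℝ → ℝ, PreservesBetweennessOn h (Set.Icc 0 1) → h 0 ≤ h 1 →
      ∃ τ ∈ Set.Ioo (0 : ℝ) 1, ContinuousAt h τ := by
    intro h hh h01
    have hmono : MonotoneOn h (Set.Icc 0 1) := by
      intro s hs t ht hst
      have m0 : (0 : ℝ) ∈ Set.Icc (0 : ℝ) 1 := by simp
      have m1 : (1 : ℝ) ∈ Set.Icc (0 : ℝ) 1 := by simp
      have a1 := (wbtw_iff_of_le h01).1 (hh 0 m0 t ht 1 m1 ((wbtw_iff_of_le zero_le_one).2 ht))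
      exact ((wbtw_iff_of_le a1.1).1 (hh 0 m0 s hs t ht ((wbtw_iff_of_le ht.1).2 ⟨hs.1, hst⟩))).2
    -- A monotone function has only countably many discontinuities, and the interval is uncountable.
    have hcount := hmono.countable_not_continuousWithinAt
    by_contra! hcon
    have : (Set.Ioo (0 : ℝ) 1).Countable := by
      refine hcount.mono fun τ hτ => ?_
      simp only [Set.mem_ofPred_eq]
      exact ⟨Set.Ioo_subset_Icc_self hτ,
        fun hc => hcon τ hτ (hc.continuousAt (Icc_mem_nhds hτ.1 hτ.2))⟩
    have h2 := Cardinal.mk_Ioo_real (zero_lt_one' ℝ)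
    have h3 := (Cardinal.le_aleph0_iff_set_countable).2 this
    rw [h2] at h3
    exact absurd h3 (not_le.2 Cardinal.aleph0_lt_continuum)
  rcases le_total (h 0) (h 1) with h01 | h01
  · exact key h hh h01
  · obtain ⟨τ, hτ, hc⟩ := key _ hh.neg (by simpa using h01)
    refine ⟨τ, hτ, ?_⟩
    simpa only [Pi.neg_def, neg_neg] using hc.neg

end RealValued

/-! ### No injective betweenness preserving real function on a triangle -/

section Triangle

variable {ι : Type*} [Fintype ι] [DecidableEq ι]

/-- On each side of a triangle there is a point at which an injective betweenness preserving function
takes a value that bounds, from above or from below, its values off that side. -/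
theorem PreservesBetweennessOn.exists_forall_lt_or_forall_gt {F : (ι → ℝ) → ℝ}
    (hF : PreservesBetweennessOn F (stdSimplex ℝ ι)) (hinj : Set.InjOn F (stdSimplex ℝ ι))
    {a b c : ι} (hab : a ≠ b) (hac : a ≠ c) (hbc : b ≠ c) (hcov : ∀ i, i = a ∨ i = b ∨ i = c) :
    ∃ o ∈ stdSimplex ℝ ι, 0 < o a ∧ 0 < o b ∧
      ((∀ x ∈ stdSimplex ℝ ι, 0 < x c → F o < F x) ∨
        (∀ x ∈ stdSimplex ℝ ι, 0 < x c → F x < F o)) := by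
  have huniv : (Finset.univ : Finset ι) = {a, b, c} := by
    ext i; simpa using hcov i
  have hsum : ∀ x : ι → ℝ, ∑ i, x i = x a + x b + x c := by
    intro x
    rw [huniv, Finset.sum_insert (by simp [hab, hac]), Finset.sum_insert (by simp [hbc]),
      Finset.sum_singleton, add_assoc]
  have hconv := convex_stdSimplex ℝ ι
  set γ : ℝ → ι → ℝ := fun t => (1 - t) • Pi.single a 1 + t • Pi.single b 1 with hγ
  have hγC : ∀ t ∈ Set.Icc (0 : ℝ) 1, γ t ∈ stdSimplex ℝ ι := fun t ht =>
    hconv (single_mem_stdSimplex ℝ a) (single_mem_stdSimplex ℝ b) (sub_nonneg.2 ht.2) ht.1 (by ring)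
  have hh : PreservesBetweennessOn (fun t => F (γ t)) (Set.Icc 0 1) := by
    intro s hs x hx t ht h
    refine hF _ (hγC s hs) _ (hγC x hx) _ (hγC t ht) ?_
    obtain ⟨α, β, hα, hβ, hαβ, rfl⟩ := wbtw_iff_exists_eq_add.1 h
    refine wbtw_iff_exists_eq_add.2 ⟨α, β, hα, hβ, hαβ, ?_⟩
    obtain rfl : α = 1 - β := by linarith
    simp only [hγ, smul_eq_mul]
    module
  -- The required point is any inner point of the side at which `F` is continuous along the side.
  obtain ⟨τ, hτ, hcontτ⟩ := exists_continuousAt_of_preservesBetweenness hh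
  have hoa : γ τ a = 1 - τ := by simp [hγ, hab]
  have hob : γ τ b = τ := by simp [hγ, hab.symm]
  have hoc : γ τ c = 0 := by simp [hγ, hac.symm, hbc.symm]
  have hoC := hγC τ ⟨hτ.1.le, hτ.2.le⟩
  refine ⟨γ τ, hoC, by rw [hoa]; linarith [hτ.2], by rw [hob]; exact hτ.1, ?_⟩
  by_contra! hcon
  obtain ⟨⟨y, hy, hyc, hFy⟩, ⟨x, hx, hxc, hFx⟩⟩ := hcon
  have hne : ∀ z ∈ stdSimplex ℝ ι, 0 < z c → F z ≠ F (γ τ) := by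
    intro z hz hzc h
    have := hinj hz hoC h
    rw [this, hoc] at hzc
    exact lt_irrefl _ hzc
  have hFy' := (hne y hy hyc).lt_of_le hFy
  have hFx' := (hne x hx hxc).symm.lt_of_le hFx
  set o := γ τ with ho
  -- The two counterexamples `x`, `y` are moved along their rays from `o` to a common height `h`
  -- over the side. The factor `1 / 2` keeps the points at twice the distance from `o` in the
  -- simplex.
  set h := min (x c) (y c) / 2 with hh'
  have hpos : 0 < h := half_pos (lt_min hxc hyc)
  have h2x : 2 * h ≤ x c := by rw [hh']; linarith [min_le_left (x c) (y c)]
  have h2y : 2 * h ≤ y c := by rw [hh']; linarith [min_le_right (x c) (y c)]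
  have hscale : ∀ z ∈ stdSimplex ℝ ι, ∀ r : ℝ, 0 ≤ r → r ≤ 1 → o + r • (z - o) ∈ stdSimplex ℝ ι := by
    intro z hz r hr hr1
    convert hconv hoC hz (sub_nonneg.2 hr1) hr (by ring) using 1
    module
  have hdbl : ∀ z ∈ stdSimplex ℝ ι, 0 < z c → 2 * h ≤ z c →
      o + (2 : ℝ) • ((h / z c) • (z - o)) ∈ stdSimplex ℝ ι := by
    intro z hz hzc h2
    rw [smul_smul]
    refine hscale z hz _ (by positivity) ?_
    rw [← mul_div_assoc]
    exact (div_le_one hzc).2 h2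
  set p : ι → ℝ := (h / x c) • (x - o) with hp
  set q : ι → ℝ := (h / y c) • (y - o) with hq
  -- At equal height `q - p` is parallel to the side, the direction in which `F` is continuous at
  -- `o`.
  set κ : ℝ := q b - p b with hκ
  set u : ι → ℝ := κ • (Pi.single b 1 - Pi.single a 1) with hu
  have hpc : p c = h := by
    simp [hp, hoc, hxc.ne']
  have hqc : q c = h := by
    simp [hq, hoc, hyc.ne']
  have hsump : p a + p b + p c = 0 := by
    rw [← hsum]
    simp only [hp, Pi.smul_apply, Pi.sub_apply, smul_eq_mul, ← Finset.mul_sum,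
      Finset.sum_sub_distrib, hx.2, hoC.2]
    ring
  have hsumq : q a + q b + q c = 0 := by
    rw [← hsum]
    simp only [hq, Pi.smul_apply, Pi.sub_apply, smul_eq_mul, ← Finset.mul_sum,
      Finset.sum_sub_distrib, hy.2, hoC.2]
    ring
  have hqpu : q = p + u := by
    ext i
    rcases hcov i with rfl | rfl | rfl
    · simp [hu, hab, hκ]; linarith
    · simp [hu, hab.symm, hκ]
    · simp [hu, hac.symm, hbc.symm, hκ, hpc, hqc]
  have huc : u c = 0 := by simp [hu, hac.symm, hbc.symm]
  have h2p := hdbl x hx hxc h2x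
  have h2q := hdbl y hy hyc h2y
  have hs1 : ∀ s : ℝ, 0 ≤ s → s ≤ 1 → o + (p + s • u) ∈ stdSimplex ℝ ι := by
    intro s hs hs1
    have : o + (2 : ℝ) • (p + s • u) ∈ stdSimplex ℝ ι := by
      convert hconv h2p h2q (sub_nonneg.2 hs1) hs (by ring) using 1
      rw [← hp, ← hq, hqpu]
      module
    convert hconv hoC this (by norm_num : (0 : ℝ) ≤ 1 / 2) (by norm_num : (0 : ℝ) ≤ 1 / 2)
      (by norm_num) using 1
    module
  have hray : ∀ z ∈ stdSimplex ℝ ι, 0 < z c → 2 * h ≤ z c →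
      Wbtw ℝ (F o) (F (o + (h / z c) • (z - o))) (F z) := by
    intro z hz hzc h2
    have hle : h / z c ≤ 1 := (div_le_one hzc).2 (by linarith)
    refine hF _ hoC _ (hscale z hz _ (by positivity) hle) _ hz
      (wbtw_iff_exists_eq_add.2 ⟨1 - h / z c, h / z c, sub_nonneg.2 hle, by positivity, by ring, ?_⟩)
    module
  have hne' : ∀ s : ℝ, 0 ≤ s → s ≤ 1 → F (o + (p + s • u)) ≠ F o := by
    intro s hs hs'
    refine hne _ (hs1 s hs hs') ?_
    simpa [hoc, hpc, huc] using hpos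
  refine hF.false_of_lt_of_lt hconv hoC (p := p) (u := u) h2p (by rw [← hqpu]; exact h2q) ?_ hne' ?_ ?_
  · intro ε hε
    have hline : ∀ s : ℝ, o + s • u = γ (τ + s * κ) := by
      intro s
      simp only [ho, hγ, hu]
      module
    have hc : ContinuousAt (fun s : ℝ => F (γ (τ + s * κ))) 0 := by
      have : ContinuousAt (fun s : ℝ => τ + s * κ) 0 := by fun_prop
      exact ContinuousAt.comp (f := fun s : ℝ => τ + s * κ) (g := fun t => F (γ t)) (x := 0)
        (by simpa using hcontτ) this
    have hmem : ∀ᶠ s : ℝ in nhds 0, τ + s * κ ∈ Set.Ioo (0 : ℝ) 1 := by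
      have : ContinuousAt (fun s : ℝ => τ + s * κ) 0 := by fun_prop
      exact this.eventually_mem (by simpa using Ioo_mem_nhds hτ.1 hτ.2)
    have hev := (Metric.continuousAt_iff'.1 hc ε hε).and hmem
    obtain ⟨η, hη, hη'⟩ := Metric.eventually_nhds_iff.1 hev
    refine ⟨η / 2, half_pos hη, fun s hs => ?_⟩
    obtain ⟨g1, g2⟩ := hη' (y := s) (by rw [Real.dist_eq, sub_zero]; linarith)
    rw [hline]
    refine ⟨hγC _ (Set.Ioo_subset_Icc_self g2), ?_⟩
    simpa [Real.dist_eq] using g1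
  · have h1 := Real.le_of_wbtw (hray x hx hxc h2x)
    have h2 := hne' 0 le_rfl zero_le_one
    simp only [zero_smul, add_zero] at h2
    refine h2.symm.lt_of_le ?_
    rcases h1 with h1 | h1
    · exact h1.1
    · linarith
  · have h1 := Real.le_of_wbtw (hray y hy hyc h2y)
    have h2 := hne' 1 zero_le_one le_rfl
    rw [one_smul] at h2
    refine h2.lt_of_le ?_
    rw [← hqpu]
    rcases h1 with h1 | h1
    · linarith
    · exact h1.2

/-- There is no injective betweenness preserving function on a triangle. -/
theorem not_injOn_of_preservesBetweennessOn_triangle {F : (Fin 3 → ℝ) → ℝ}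
    (hF : PreservesBetweennessOn F (stdSimplex ℝ (Fin 3))) :
    ¬ Set.InjOn F (stdSimplex ℝ (Fin 3)) := by
  intro hinj
  obtain ⟨x, hx, hx0, hx1, h⟩ := hF.exists_forall_lt_or_forall_gt hinj (a := 0) (b := 1) (c := 2)
    (by decide) (by decide) (by decide) (by decide)
  obtain ⟨y, hy, hy1, hy2, h'⟩ := hF.exists_forall_lt_or_forall_gt hinj (a := 1) (b := 2) (c := 0)
    (by decide) (by decide) (by decide) (by decide)
  obtain ⟨z, hz, hz2, hz0, h''⟩ := hF.exists_forall_lt_or_forall_gt hinj (a := 2) (b := 0) (c := 1)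
    (by decide) (by decide) (by decide) (by decide)
  -- Two of the three points bound in the same direction. Each lies off the other's side, so each
  -- value would be strictly smaller (or strictly larger) than the other.
  rcases h with h | h <;> rcases h' with h' | h' <;> rcases h'' with h'' | h'' <;>
  first
  | exact lt_asymm (h y hy hy2) (h' x hx hx0)
  | exact lt_asymm (h' z hz hz0) (h'' y hy hy1)
  | exact lt_asymm (h z hz hz2) (h'' x hx hx1)

end Triangle

/-! ### Faces of the standard simplex and the midpoints of its edges -/

section StdSimplex

theorem eq_zero_of_mem_convexHull_single {ι : Type*} [DecidableEq ι] {s : Set ι} {x : ι → ℝ}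
    (hx : x ∈ convexHull ℝ ((fun i : ι => (Pi.single i 1 : ι → ℝ)) '' s)) {j : ι}
    (hj : j ∉ s) : x j = 0 := by
  have hsub : convexHull ℝ ((fun i : ι => (Pi.single i 1 : ι → ℝ)) '' s) ⊆
      {x | x j = 0} := by
    refine convexHull_min ?_ ?_
    · rintro _ ⟨i, hi, rfl⟩
      have : j ≠ i := by rintro rfl; exact hj hi
      simp [this]
    · intro x hx y hy a b _ _ _
      simp only [Set.mem_ofPred_eq] at hx hy
      simp [hx, hy]
  exact hsub hx

theorem const_mem_stdSimplex {ι : Type*} [Fintype ι] [Nonempty ι] :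
    (fun _ => (Fintype.card ι : ℝ)⁻¹) ∈ stdSimplex ℝ ι := by
  have : (0 : ℝ) < Fintype.card ι := by exact_mod_cast Fintype.card_pos
  exact ⟨fun _ => by positivity, by simp [this.ne']⟩

variable {ι : Type*} [Fintype ι] [DecidableEq ι]

theorem eq_single_of_mem_stdSimplex {x : ι → ℝ} (hx : x ∈ stdSimplex ℝ ι) {i : ι} (hi : x i = 1) :
    x = Pi.single i 1 := by
  have h := hx.2
  rw [← Finset.add_sum_erase _ _ (Finset.mem_univ i), hi, add_eq_left] at h
  have h' := (Finset.sum_eq_zero_iff_of_nonneg fun j _ => hx.1 j).1 h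
  ext j
  rcases eq_or_ne j i with rfl | hj
  · simpa using hi
  · simpa [hj] using h' j (by simp [hj])

/-- A point of the standard simplex other than the vertex `i` lies between this vertex and a point of
the opposite face. -/
theorem exists_mem_opposite_face {x : ι → ℝ} (hx : x ∈ stdSimplex ℝ ι) {i : ι} (hi : x i ≠ 1) :
    ∃ y ∈ stdSimplex ℝ ι, y i = 0 ∧ (∀ j, j ≠ i → (1 - x i) * y j = x j) ∧
      x = x i • Pi.single i 1 + (1 - x i) • y := by
  have h1 : x i < 1 := lt_of_le_of_ne (mem_Icc_of_mem_stdSimplex hx i).2 hi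
  have hpos : 0 < 1 - x i := sub_pos.2 h1
  set y : ι → ℝ := (1 - x i)⁻¹ • (x - x i • Pi.single i 1) with hy
  have hyi : y i = 0 := by simp [hy]
  have hyj : ∀ j, j ≠ i → (1 - x i) * y j = x j := by
    intro j hj
    simp [hy, hj, hpos.ne']
  refine ⟨y, ⟨fun j => ?_, ?_⟩, hyi, hyj, ?_⟩
  · rcases eq_or_ne j i with rfl | hj
    · exact hyi.ge
    · have := hyj j hj
      have h0 := hx.1 j
      rw [← this] at h0
      exact nonneg_of_mul_nonneg_right h0 hpos
  · simp only [hy, Pi.smul_apply, Pi.sub_apply, smul_eq_mul, ← Finset.mul_sum,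
      Finset.sum_sub_distrib, hx.2]
    simp [hpos.ne']
  · rw [hy, smul_inv_smul₀ hpos.ne']
    module

/-- A betweenness preserving map sends each face of the standard simplex into the convex hull of the
images of its vertices. -/
theorem PreservesBetweennessOn.mem_convexHull_image {V : Type*} [AddCommGroup V] [Module ℝ V]
    {f : (ι → ℝ) → V} (hf : PreservesBetweennessOn f (stdSimplex ℝ ι)) (s : Finset ι) :
    ∀ x ∈ stdSimplex ℝ ι, (∀ i, i ∉ s → x i = 0) →
      f x ∈ convexHull ℝ ((fun i => f (Pi.single i 1)) '' (s : Set ι)) := by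
  induction s using Finset.induction_on with
  | empty =>
    intro x hx h
    have := hx.2
    simp [h] at this
  | insert i s his ih =>
    intro x hx h
    have hi : f (Pi.single i 1) ∈
        convexHull ℝ ((fun i => f (Pi.single i 1)) '' ((insert i s : Finset ι) : Set ι)) :=
      subset_convexHull ℝ _ ⟨i, by simp, rfl⟩
    by_cases hxi : x i = 1
    · rw [eq_single_of_mem_stdSimplex hx hxi]
      exact hi
    obtain ⟨y, hy, hyi, hyj, hxy⟩ := exists_mem_opposite_face hx hxi
    have h1 := (mem_Icc_of_mem_stdSimplex hx i)
    have hpos : 0 < 1 - x i := sub_pos.2 (lt_of_le_of_ne h1.2 hxi)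
    have hy' := ih y hy (by
      intro j hj
      rcases eq_or_ne j i with rfl | hji
      · exact hyi
      · have := hyj j hji
        rw [h j (by simp [hj, hji])] at this
        exact (mul_eq_zero.1 this).resolve_left hpos.ne')
    have hy'' := convexHull_mono (Set.image_mono (f := fun i => f (Pi.single i 1))
      (Finset.coe_subset.2 (Finset.subset_insert i s))) hy'
    refine (convex_convexHull ℝ _).segment_subset hi hy'' (mem_segment_iff_wbtw.2 ?_)
    exact hf _ (single_mem_stdSimplex ℝ i) _ hx _ hy
      (wbtw_iff_exists_eq_add.2 ⟨x i, 1 - x i, h1.1, hpos.le, by ring, hxy⟩)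

section FixedPoints

variable {G : (ι → ℝ) → ι → ℝ}

theorem PreservesBetweennessOn.mapsTo_stdSimplex (hG : PreservesBetweennessOn G (stdSimplex ℝ ι))
    (hvert : ∀ i, G (Pi.single i 1) = Pi.single i 1) {x : ι → ℝ} (hx : x ∈ stdSimplex ℝ ι) :
    G x ∈ stdSimplex ℝ ι := by
  have h := hG.mem_convexHull_image Finset.univ x hx (by simp)
  simp only [hvert, Finset.coe_univ, Set.image_univ] at h
  rwa [convexHull_rangle_single_eq_stdSimplex] at h

theorem PreservesBetweennessOn.apply_eq_zero (hG : PreservesBetweennessOn G (stdSimplex ℝ ι))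
    (hvert : ∀ i, G (Pi.single i 1) = Pi.single i 1) {x : ι → ℝ} (hx : x ∈ stdSimplex ℝ ι) {i : ι}
    (hi : x i = 0) : G x i = 0 := by
  have h := hG.mem_convexHull_image (Finset.univ.erase i) x hx (by simpa using hi)
  simp only [hvert] at h
  exact eq_zero_of_mem_convexHull_single h (by simp)

/-- A betweenness preserving self-map of a simplex of dimension at least two that fixes the vertices
and the barycenter fixes the midpoints of the edges. -/
theorem PreservesBetweennessOn.map_midpoint_single (hG : PreservesBetweennessOn G (stdSimplex ℝ ι))
    (hcard : 3 ≤ Fintype.card ι) (hvert : ∀ i, G (Pi.single i 1) = Pi.single i 1)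
    (hbary : G (fun _ => (Fintype.card ι : ℝ)⁻¹) = fun _ => (Fintype.card ι : ℝ)⁻¹)
    {i j : ι} (hij : i ≠ j) :
    G ((1 / 2 : ℝ) • (Pi.single i 1 + Pi.single j 1)) =
      (1 / 2 : ℝ) • (Pi.single i 1 + Pi.single j 1) := by
  have : Nonempty ι := ⟨i⟩
  set n : ℝ := (Fintype.card ι : ℝ) with hn
  have hn3 : (3 : ℝ) ≤ n := by rw [hn]; exact_mod_cast hcard
  set M : ι → ℝ := (1 / 2 : ℝ) • (Pi.single i 1 + Pi.single j 1) with hM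
  have hMe : M = (1 / 2 : ℝ) • Pi.single i 1 + (1 / 2 : ℝ) • Pi.single j 1 := by
    rw [hM, smul_add]
  have hMK : M ∈ stdSimplex ℝ ι := by
    rw [hMe]
    exact convex_stdSimplex ℝ ι (single_mem_stdSimplex ℝ i) (single_mem_stdSimplex ℝ j)
      (by norm_num) (by norm_num) (by norm_num)
  -- `M'` is the barycenter of the face opposite the edge. The barycenter of the simplex lies
  -- between `M` and `M'`. As `G M'` stays in the opposite face, the coordinates `i` and `j` of the
  -- fixed barycenter come from `G M` alone, which makes them equal there.
  set M' : ι → ℝ := (n - 2)⁻¹ • (1 - Pi.single i 1 - Pi.single j 1) with hM'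
  have hM'i : M' i = 0 := by simp [hM', hij]
  have hM'j : M' j = 0 := by simp [hM', hij.symm]
  have hn2 : 0 < n - 2 := by linarith
  have hM'K : M' ∈ stdSimplex ℝ ι := by
    refine ⟨fun k => ?_, ?_⟩
    · rcases eq_or_ne k i with rfl | hki
      · exact hM'i.ge
      rcases eq_or_ne k j with rfl | hkj
      · exact hM'j.ge
      simp [hM', hki, hkj, hn2.le]
    · simp only [hM', Pi.smul_apply, Pi.sub_apply, smul_eq_mul, ← Finset.mul_sum,
        Finset.sum_sub_distrib]
      simp only [Pi.one_apply, Finset.sum_const, Finset.card_univ, nsmul_eq_mul, mul_one,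
        Finset.sum_pi_single', Finset.mem_univ, if_true, ← hn]
      field_simp
      ring
  have hw : Wbtw ℝ M (fun _ => n⁻¹) M' := by
    refine wbtw_iff_exists_eq_add.2 ⟨2 / n, 1 - 2 / n, by positivity,
      sub_nonneg.2 ((div_le_one (by linarith)).2 (by linarith)), by ring, ?_⟩
    have hn0 : n ≠ 0 := by linarith
    ext k
    have e : (1 - 2 / n) * (n - 2)⁻¹ = n⁻¹ := by field_simp
    simp only [hMe, hM', Pi.add_apply, Pi.smul_apply, smul_eq_mul, Pi.sub_apply, Pi.one_apply]
    rw [← mul_assoc, e]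
    field_simp
    ring
  have hw' := hG _ hMK _ const_mem_stdSimplex _ hM'K hw
  rw [hbary] at hw'
  obtain ⟨s, t, -, -, -, hst⟩ := wbtw_iff_exists_eq_add.1 hw'
  have hi := congrFun hst i
  have hj := congrFun hst j
  simp only [Pi.add_apply, Pi.smul_apply, smul_eq_mul, hG.apply_eq_zero hvert hM'K hM'i,
    hG.apply_eq_zero hvert hM'K hM'j, mul_zero, add_zero] at hi hj
  have hs : s ≠ 0 := by
    rintro rfl
    rw [zero_mul, inv_eq_zero] at hi
    linarith
  have heq : G M i = G M j := mul_left_cancel₀ hs (hi.symm.trans hj)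
  have hz : ∀ k, k ≠ i → k ≠ j → G M k = 0 := fun k hki hkj =>
    hG.apply_eq_zero hvert hMK (by simp [hMe, hki, hkj])
  have hsum := (hG.mapsTo_stdSimplex hvert hMK).2
  rw [Fintype.sum_eq_add i j hij (fun k hk => hz k hk.1 hk.2)] at hsum
  ext k
  rcases eq_or_ne k i with rfl | hki
  · have hk : M k = 1 / 2 := by simp [hMe, hij]
    rw [hk]; linarith
  rcases eq_or_ne k j with rfl | hkj
  · have hk : M k = 1 / 2 := by simp [hMe, hij.symm]
    rw [hk]; linarith
  rw [hz k hki hkj]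
  simp [hMe, hki, hkj]

end FixedPoints

end StdSimplex

/-! ### Fixing a triangle by iterated subdivision -/

section Subdivision

variable {E : Type*} [AddCommGroup E] [Module ℝ E]

/-- The map `G` fixes the vertices `p`, `q`, `r` of a triangle in `C` and the midpoints of its sides. -/
structure FixesVerticesAndMidpoints (G : E → E) (C : Set E) (p q r : E) : Prop where
  mem₁ : p ∈ C
  mem₂ : q ∈ C
  mem₃ : r ∈ C
  linearIndependent : ∀ α β γ : ℝ, α • p + β • q + γ • r = 0 → α = 0 ∧ β = 0 ∧ γ = 0
  vertex₁ : G p = p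
  vertex₂ : G q = q
  vertex₃ : G r = r
  midpoint₁ : G ((1 / 2 : ℝ) • (q + r)) = (1 / 2 : ℝ) • (q + r)
  midpoint₂ : G ((1 / 2 : ℝ) • (r + p)) = (1 / 2 : ℝ) • (r + p)
  midpoint₃ : G ((1 / 2 : ℝ) • (p + q)) = (1 / 2 : ℝ) • (p + q)

namespace FixesVerticesAndMidpoints

variable {G : E → E} {C : Set E} {p q r : E}

theorem rotate (h : FixesVerticesAndMidpoints G C p q r) : FixesVerticesAndMidpoints G C q r p where
  mem₁ := h.mem₂
  mem₂ := h.mem₃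
  mem₃ := h.mem₁
  linearIndependent α β γ e := by
    obtain ⟨h1, h2, h3⟩ := h.linearIndependent γ α β (by rw [← e]; abel)
    exact ⟨h2, h3, h1⟩
  vertex₁ := h.vertex₂
  vertex₂ := h.vertex₃
  vertex₃ := h.vertex₁
  midpoint₁ := h.midpoint₂
  midpoint₂ := h.midpoint₃
  midpoint₃ := h.midpoint₁

theorem swap (h : FixesVerticesAndMidpoints G C p q r) : FixesVerticesAndMidpoints G C p r q where
  mem₁ := h.mem₁
  mem₂ := h.mem₃
  mem₃ := h.mem₂
  linearIndependent α β γ e := by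
    obtain ⟨h1, h2, h3⟩ := h.linearIndependent α γ β (by rw [← e]; abel)
    exact ⟨h1, h3, h2⟩
  vertex₁ := h.vertex₁
  vertex₂ := h.vertex₃
  vertex₃ := h.vertex₂
  midpoint₁ := by rw [add_comm]; exact h.midpoint₁
  midpoint₂ := by rw [add_comm]; exact h.midpoint₃
  midpoint₃ := by rw [add_comm]; exact h.midpoint₂

theorem combination_mem (h : FixesVerticesAndMidpoints G C p q r) (hC : Convex ℝ C)
    {α β γ : ℝ} (hα : 0 ≤ α) (hβ : 0 ≤ β) (hγ : 0 ≤ γ) (hs : α + β + γ = 1) :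
    α • p + β • q + γ • r ∈ C := by
  have := hC.sum_mem (t := Finset.univ) (w := ![α, β, γ]) (z := ![p, q, r])
    (by intro i _; fin_cases i <;> assumption) (by simpa [Fin.sum_univ_three] using hs)
    (by intro i _; fin_cases i; exacts [h.mem₁, h.mem₂, h.mem₃])
  simpa [Fin.sum_univ_three] using this

theorem coeff_eq (h : FixesVerticesAndMidpoints G C p q r) {α β γ α' β' γ' : ℝ}
    (e : α • p + β • q + γ • r = α' • p + β' • q + γ' • r) : α = α' ∧ β = β' ∧ γ = γ' := by
  obtain ⟨h1, h2, h3⟩ := h.linearIndependent (α - α') (β - β') (γ - γ') (by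
    rw [← sub_eq_zero] at e; rw [← e]; module)
  exact ⟨sub_eq_zero.1 h1, sub_eq_zero.1 h2, sub_eq_zero.1 h3⟩

theorem map_combination (h : FixesVerticesAndMidpoints G C p q r) (hC : Convex ℝ C)
    (hG : PreservesBetweennessOn G C)
    {α β γ : ℝ} (hα : 0 ≤ α) (hβ : 0 ≤ β) (hγ : 0 ≤ γ) (hs : α + β + γ = 1) :
    ∃ α' β' γ' : ℝ, 0 ≤ α' ∧ 0 ≤ β' ∧ 0 ≤ γ' ∧ α' + β' + γ' = 1 ∧
      G (α • p + β • q + γ • r) = α' • p + β' • q + γ' • r := by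
  have hα1 : α ≤ 1 := by linarith
  rcases hα1.eq_or_lt with rfl | hα1
  · obtain rfl : β = 0 := by linarith
    obtain rfl : γ = 0 := by linarith
    exact ⟨1, 0, 0, by norm_num, le_rfl, le_rfl, by norm_num, by simp [h.vertex₁]⟩
  have hpos : 0 < 1 - α := sub_pos.2 hα1
  set y : E := (β / (1 - α)) • q + (γ / (1 - α)) • r with hy
  have hsum : β / (1 - α) + γ / (1 - α) = 1 := by
    rw [← add_div, div_eq_one_iff_eq hpos.ne']; linarith
  have hyC : y ∈ C := hC h.mem₂ h.mem₃ (by positivity) (by positivity) hsum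
  obtain ⟨s, t, hs0, ht0, hst, e⟩ := wbtw_iff_exists_eq_add.1 (hG _ h.mem₂ _ hyC _ h.mem₃
    (wbtw_iff_exists_eq_add.2 ⟨_, _, by positivity, by positivity, hsum, hy⟩))
  have hxy : α • p + β • q + γ • r = α • p + (1 - α) • y := by
    rw [hy]
    match_scalars <;> field_simp
  obtain ⟨s', t', hs0', ht0', hst', e'⟩ := wbtw_iff_exists_eq_add.1 (hG _ h.mem₁ _
    (h.combination_mem hC hα hβ hγ hs) _ hyC
    (wbtw_iff_exists_eq_add.2 ⟨α, 1 - α, hα, hpos.le, by ring, hxy⟩))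
  refine ⟨s', t' * s, t' * t, hs0', by positivity, by positivity, ?_, ?_⟩
  · rw [add_assoc, ← mul_add, hst, mul_one, hst']
  · rw [e', e, h.vertex₁, h.vertex₂, h.vertex₃]
    module

/-- The point is the intersection of the median from `p` with the segment joining the midpoints of
`p q` and `p r`. The ends of both segments are fixed, so the image lies on both as well. -/
theorem map_inner_midpoint (h : FixesVerticesAndMidpoints G C p q r) (hC : Convex ℝ C)
    (hG : PreservesBetweennessOn G C) :
    G ((1 / 2 : ℝ) • p + (1 / 4 : ℝ) • q + (1 / 4 : ℝ) • r) =
      (1 / 2 : ℝ) • p + (1 / 4 : ℝ) • q + (1 / 4 : ℝ) • r := by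
  have hx := h.combination_mem hC (α := 1 / 2) (β := 1 / 4) (γ := 1 / 4)
    (by norm_num) (by norm_num) (by norm_num) (by norm_num)
  have h₁ : (1 / 2 : ℝ) • (q + r) ∈ C := by
    convert h.combination_mem hC (α := 0) (β := 1 / 2) (γ := 1 / 2)
      (by norm_num) (by norm_num) (by norm_num) (by norm_num) using 1
    module
  have h₂ : (1 / 2 : ℝ) • (r + p) ∈ C := by
    convert h.combination_mem hC (α := 1 / 2) (β := 0) (γ := 1 / 2)
      (by norm_num) (by norm_num) (by norm_num) (by norm_num) using 1
    module
  have h₃ : (1 / 2 : ℝ) • (p + q) ∈ C := by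
    convert h.combination_mem hC (α := 1 / 2) (β := 1 / 2) (γ := 0)
      (by norm_num) (by norm_num) (by norm_num) (by norm_num) using 1
    module
  obtain ⟨s, t, -, -, hst, e⟩ := wbtw_iff_exists_eq_add.1 (hG _ h.mem₁ _ hx _ h₁
    (wbtw_iff_exists_eq_add.2 ⟨1 / 2, 1 / 2, by norm_num, by norm_num, by norm_num, by module⟩))
  obtain ⟨s', t', -, -, hst', e'⟩ := wbtw_iff_exists_eq_add.1 (hG _ h₃ _ hx _ h₂
    (wbtw_iff_exists_eq_add.2 ⟨1 / 2, 1 / 2, by norm_num, by norm_num, by norm_num, by module⟩))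
  rw [h.vertex₁, h.midpoint₁] at e
  rw [h.midpoint₂, h.midpoint₃] at e'
  obtain ⟨h1, h2, h3⟩ := h.coeff_eq (α := s) (β := t / 2) (γ := t / 2)
    (α' := (s' + t') / 2) (β' := s' / 2) (γ' := t' / 2) (by
      trans s • p + t • (1 / 2 : ℝ) • (q + r)
      · module
      · rw [← e, e']; module)
  obtain rfl : s = 1 / 2 := by linarith
  obtain rfl : t = 1 / 2 := by linarith
  rw [e]
  module

/-- The inner midpoint near `p` is halfway between this point and the inner midpoint near `r`. Both
inner midpoints are fixed, so the image is on the line through them, which meets the side `p q` only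
here. -/
theorem map_quarter_point (h : FixesVerticesAndMidpoints G C p q r) (hC : Convex ℝ C)
    (hG : PreservesBetweennessOn G C) :
    G ((3 / 4 : ℝ) • p + (1 / 4 : ℝ) • q) = (3 / 4 : ℝ) • p + (1 / 4 : ℝ) • q := by
  have h₀ : (3 / 4 : ℝ) • p + (1 / 4 : ℝ) • q ∈ C :=
    hC h.mem₁ h.mem₂ (by norm_num) (by norm_num) (by norm_num)
  have hx := h.combination_mem hC (α := 1 / 2) (β := 1 / 4) (γ := 1 / 4)
    (by norm_num) (by norm_num) (by norm_num) (by norm_num)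
  have hz := h.rotate.rotate.combination_mem hC (α := 1 / 2) (β := 1 / 4) (γ := 1 / 4)
    (by norm_num) (by norm_num) (by norm_num) (by norm_num)
  obtain ⟨s, t, -, -, hst, e⟩ := wbtw_iff_exists_eq_add.1 (hG _ h.mem₁ _ h₀ _ h.mem₂
    (wbtw_iff_exists_eq_add.2 ⟨3 / 4, 1 / 4, by norm_num, by norm_num, by norm_num, rfl⟩))
  obtain ⟨s', t', -, -, hst', e'⟩ := wbtw_iff_exists_eq_add.1 (hG _ h₀ _ hx _ hz
    (wbtw_iff_exists_eq_add.2 ⟨1 / 2, 1 / 2, by norm_num, by norm_num, by norm_num, by module⟩))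
  rw [h.map_inner_midpoint hC hG, h.rotate.rotate.map_inner_midpoint hC hG, e, h.vertex₁,
    h.vertex₂] at e'
  obtain ⟨h1, h2, h3⟩ := h.coeff_eq (α := 1 / 2) (β := 1 / 4) (γ := 1 / 4)
    (α' := s' * s + t' / 4) (β' := s' * t + t' / 4) (γ' := t' / 2) (by rw [e']; module)
  obtain rfl : t' = 1 / 2 := by linarith
  obtain rfl : s' = 1 / 2 := by linarith
  obtain rfl : s = 3 / 4 := by linarith
  obtain rfl : t = 1 / 4 := by linarith
  rw [e, h.vertex₁, h.vertex₂]

/-- Subdivision step: the new midpoints are one inner midpoint and two quarter points of the old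
triangle. -/
theorem corner (h : FixesVerticesAndMidpoints G C p q r) (hC : Convex ℝ C)
    (hG : PreservesBetweennessOn G C) :
    FixesVerticesAndMidpoints G C p ((1 / 2 : ℝ) • (p + q)) ((1 / 2 : ℝ) • (p + r)) where
  mem₁ := h.mem₁
  mem₂ := by
    rw [smul_add]; exact hC h.mem₁ h.mem₂ (by norm_num) (by norm_num) (by norm_num)
  mem₃ := by
    rw [smul_add]; exact hC h.mem₁ h.mem₃ (by norm_num) (by norm_num) (by norm_num)
  linearIndependent α β γ e := by
    obtain ⟨h1, h2, h3⟩ := h.linearIndependent (α + β / 2 + γ / 2) (β / 2) (γ / 2) (by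
      rw [← e]; module)
    exact ⟨by linarith, by linarith, by linarith⟩
  vertex₁ := h.vertex₁
  vertex₂ := h.midpoint₃
  vertex₃ := by rw [add_comm]; exact h.midpoint₂
  midpoint₁ := by
    convert h.map_inner_midpoint hC hG using 2 <;> module
  midpoint₂ := by
    convert h.swap.map_quarter_point hC hG using 2 <;> module
  midpoint₃ := by
    convert h.map_quarter_point hC hG using 2 <;> module

/-- Subdivision step: the new midpoints are the three inner midpoints of the old triangle. -/
theorem medial (h : FixesVerticesAndMidpoints G C p q r) (hC : Convex ℝ C)
    (hG : PreservesBetweennessOn G C) :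
    FixesVerticesAndMidpoints G C ((1 / 2 : ℝ) • (q + r)) ((1 / 2 : ℝ) • (r + p))
      ((1 / 2 : ℝ) • (p + q)) where
  mem₁ := by
    rw [smul_add]; exact hC h.mem₂ h.mem₃ (by norm_num) (by norm_num) (by norm_num)
  mem₂ := by
    rw [smul_add]; exact hC h.mem₃ h.mem₁ (by norm_num) (by norm_num) (by norm_num)
  mem₃ := by
    rw [smul_add]; exact hC h.mem₁ h.mem₂ (by norm_num) (by norm_num) (by norm_num)
  linearIndependent α β γ e := by
    obtain ⟨h1, h2, h3⟩ := h.linearIndependent ((β + γ) / 2) ((γ + α) / 2) ((α + β) / 2) (by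
      rw [← e]; module)
    exact ⟨by linarith, by linarith, by linarith⟩
  vertex₁ := h.midpoint₁
  vertex₂ := h.midpoint₂
  vertex₃ := h.midpoint₃
  midpoint₁ := by
    convert h.map_inner_midpoint hC hG using 2 <;> module
  midpoint₂ := by
    convert h.rotate.map_inner_midpoint hC hG using 2 <;> module
  midpoint₃ := by
    convert h.rotate.rotate.map_inner_midpoint hC hG using 2 <;> module

/-- By iterated subdivision, a point of the triangle is moved by an arbitrarily small amount. -/
theorem abs_sub_le (hC : Convex ℝ C) (hG : PreservesBetweennessOn G C) (φ : E →ₗ[ℝ] ℝ) (n : ℕ) :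
    ∀ {p q r : E}, FixesVerticesAndMidpoints G C p q r → ∀ {δ : ℝ}, |φ p - φ q| ≤ δ →
      |φ q - φ r| ≤ δ → |φ r - φ p| ≤ δ → ∀ {α β γ : ℝ}, 0 ≤ α → 0 ≤ β → 0 ≤ γ → α + β + γ = 1 →
      |φ (G (α • p + β • q + γ • r)) - φ (α • p + β • q + γ • r)| ≤ 2 * δ / 2 ^ n := by
  induction n with
  | zero =>
    intro p q r h δ h1 h2 h3 α β γ hα hβ hγ hs
    obtain ⟨α', β', γ', hα', hβ', hγ', hs', e⟩ := h.map_combination hC hG hα hβ hγ hs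
    -- Without subdivision, a point and its image both lie in the triangle, where `φ` differs from
    -- `φ p` by at most `δ`.
    have key : ∀ {a b c : ℝ}, 0 ≤ a → 0 ≤ b → 0 ≤ c → a + b + c = 1 →
        |φ (a • p + b • q + c • r) - φ p| ≤ δ := by
      intro a b c ha hb hc habc
      obtain rfl : a = 1 - b - c := by linarith
      rw [abs_le] at h1 h3 ⊢
      simp only [map_add, map_smul, smul_eq_mul]
      constructor <;> nlinarith
    have k1 := abs_le.1 (key hα hβ hγ hs)
    have k2 := abs_le.1 (key hα' hβ' hγ' hs')
    rw [e, pow_zero, div_one, abs_le]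
    constructor <;> linarith
  | succ n ih =>
    -- A point with `1 / 2 ≤ α` lies in the corner triangle at `p`, where the differences of `φ`
    -- between vertices are halved. If no coordinate exceeds `1 / 2`, the point lies in the medial
    -- triangle.
    have corner_case : ∀ {p q r : E}, FixesVerticesAndMidpoints G C p q r → ∀ {δ : ℝ},
        |φ p - φ q| ≤ δ → |φ q - φ r| ≤ δ → |φ r - φ p| ≤ δ → ∀ {α β γ : ℝ}, 0 ≤ α → 0 ≤ β →
        0 ≤ γ → α + β + γ = 1 → 1 / 2 ≤ α →
        |φ (G (α • p + β • q + γ • r)) - φ (α • p + β • q + γ • r)| ≤ 2 * δ / 2 ^ (n + 1) := by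
      intro p q r h δ h1 h2 h3 α β γ hα hβ hγ hs hα2
      have := ih (h.corner hC hG) (δ := δ / 2) (α := 2 * α - 1) (β := 2 * β) (γ := 2 * γ)
        (by simp only [map_add, map_smul, smul_eq_mul]; rw [abs_le] at *; constructor <;> linarith)
        (by simp only [map_add, map_smul, smul_eq_mul]; rw [abs_le] at *; constructor <;> linarith)
        (by simp only [map_add, map_smul, smul_eq_mul]; rw [abs_le] at *; constructor <;> linarith)
        (by linarith) (by linarith) (by linarith) (by linarith)
      have e : (2 * α - 1) • p + (2 * β) • (1 / 2 : ℝ) • (p + q) + (2 * γ) • (1 / 2 : ℝ) • (p + r) =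
          α • p + β • q + γ • r := by
        obtain rfl : α = 1 - β - γ := by linarith
        module
      rw [e] at this
      refine this.trans_eq ?_
      rw [pow_succ]; field_simp
    intro p q r h δ h1 h2 h3 α β γ hα hβ hγ hs
    rcases le_total (1 / 2) α with hα2 | hα2
    · exact corner_case h h1 h2 h3 hα hβ hγ hs hα2
    rcases le_total (1 / 2) β with hβ2 | hβ2
    · have := corner_case h.rotate h2 h3 h1 hβ hγ hα (by linarith) hβ2
      rwa [show β • q + γ • r + α • p = α • p + β • q + γ • r by abel] at this
    rcases le_total (1 / 2) γ with hγ2 | hγ2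
    · have := corner_case h.rotate.rotate h3 h1 h2 hγ hα hβ (by linarith) hγ2
      rwa [show γ • r + α • p + β • q = α • p + β • q + γ • r by abel] at this
    have := ih (h.medial hC hG) (δ := δ / 2) (α := 1 - 2 * α) (β := 1 - 2 * β) (γ := 1 - 2 * γ)
      (by simp only [map_add, map_smul, smul_eq_mul]; rw [abs_le] at *; constructor <;> linarith)
      (by simp only [map_add, map_smul, smul_eq_mul]; rw [abs_le] at *; constructor <;> linarith)
      (by simp only [map_add, map_smul, smul_eq_mul]; rw [abs_le] at *; constructor <;> linarith)
      (by linarith) (by linarith) (by linarith) (by linarith)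
    have e : (1 - 2 * α) • (1 / 2 : ℝ) • (q + r) + (1 - 2 * β) • (1 / 2 : ℝ) • (r + p) +
        (1 - 2 * γ) • (1 / 2 : ℝ) • (p + q) = α • p + β • q + γ • r := by
      obtain rfl : α = 1 - β - γ := by linarith
      module
    rw [e] at this
    refine this.trans_eq ?_
    rw [pow_succ]; field_simp

theorem map_eq_self {ι : Type*} {G : (ι → ℝ) → ι → ℝ} {C : Set (ι → ℝ)} {p q r : ι → ℝ}
    (h : FixesVerticesAndMidpoints G C p q r) (hC : Convex ℝ C)
    (hG : PreservesBetweennessOn G C) {α β γ : ℝ} (hα : 0 ≤ α) (hβ : 0 ≤ β) (hγ : 0 ≤ γ)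
    (hs : α + β + γ = 1) :
    G (α • p + β • q + γ • r) = α • p + β • q + γ • r := by
  ext i
  set φ : (ι → ℝ) →ₗ[ℝ] ℝ := LinearMap.proj i
  set δ := |φ p - φ q| + |φ q - φ r| + |φ r - φ p| with hδ
  have h1 := abs_nonneg (φ p - φ q)
  have h2 := abs_nonneg (φ q - φ r)
  have h3 := abs_nonneg (φ r - φ p)
  have key : ∀ n : ℕ, |φ (G (α • p + β • q + γ • r)) - φ (α • p + β • q + γ • r)| ≤
      2 * δ / 2 ^ n := fun n => abs_sub_le hC hG φ n h (by linarith) (by linarith) (by linarith)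
        hα hβ hγ hs
  have hlim : Filter.Tendsto (fun n : ℕ => 2 * δ / 2 ^ n) Filter.atTop (nhds 0) := by
    have := (tendsto_pow_atTop_nhds_zero_of_lt_one (r := (1 / 2 : ℝ)) (by norm_num)
      (by norm_num)).const_mul (2 * δ)
    simpa [div_eq_mul_inv] using this
  have h0 := ge_of_tendsto' hlim key
  exact sub_eq_zero.1 (abs_nonpos_iff.1 h0)

end FixesVerticesAndMidpoints

end Subdivision

/-! ### Rigidity: vertices and barycenter fixed imply the identity -/

section Identity

variable {ι : Type*} [Fintype ι] [DecidableEq ι] {G : (ι → ℝ) → ι → ℝ}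

/-- A betweenness preserving self-map of a simplex of dimension at least two that fixes the vertices
and the barycenter fixes the edges. -/
theorem PreservesBetweennessOn.map_eq_self_of_edge (hG : PreservesBetweennessOn G (stdSimplex ℝ ι))
    (hcard : 3 ≤ Fintype.card ι) (hvert : ∀ i, G (Pi.single i 1) = Pi.single i 1)
    (hbary : G (fun _ => (Fintype.card ι : ℝ)⁻¹) = fun _ => (Fintype.card ι : ℝ)⁻¹)
    {i j : ι} (hij : i ≠ j) {x : ι → ℝ} (hx : x ∈ stdSimplex ℝ ι)
    (hxs : ∀ l, l ≠ i → l ≠ j → x l = 0) : G x = x := by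
  -- A third vertex makes the edge a side of a triangle, to which subdivision applies.
  obtain ⟨k, hk⟩ : ∃ k, k ∉ ({i, j} : Finset ι) := by
    by_contra! hcon
    have := Finset.card_le_card (fun a _ => hcon a : (Finset.univ : Finset ι) ⊆ {i, j})
    rw [Finset.card_univ] at this
    have h2 := Finset.card_le_two (a := i) (b := j)
    omega
  have hki : k ≠ i := by rintro rfl; simp at hk
  have hkj : k ≠ j := by rintro rfl; simp at hk
  have hmid : ∀ {a b : ι}, a ≠ b → G ((1 / 2 : ℝ) • (Pi.single a 1 + Pi.single b 1)) =
      (1 / 2 : ℝ) • (Pi.single a 1 + Pi.single b 1) :=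
    fun hab => hG.map_midpoint_single hcard hvert hbary hab
  have h : FixesVerticesAndMidpoints G (stdSimplex ℝ ι) (Pi.single i 1) (Pi.single j 1)
      (Pi.single k 1) :=
    { mem₁ := single_mem_stdSimplex ℝ i
      mem₂ := single_mem_stdSimplex ℝ j
      mem₃ := single_mem_stdSimplex ℝ k
      linearIndependent := by
        intro α β γ e
        have e1 := congrFun e i
        have e2 := congrFun e j
        have e3 := congrFun e k
        simp [hij, hki.symm] at e1
        simp [hij.symm, hkj.symm] at e2
        simp [hki, hkj] at e3
        exact ⟨e1, e2, e3⟩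
      vertex₁ := hvert i
      vertex₂ := hvert j
      vertex₃ := hvert k
      midpoint₁ := hmid hkj.symm
      midpoint₂ := hmid hki
      midpoint₃ := hmid hij }
  have hsum := hx.2
  rw [Fintype.sum_eq_add i j hij (fun k hk => hxs k hk.1 hk.2)] at hsum
  have e : x = x i • Pi.single i 1 + x j • Pi.single j 1 + (0 : ℝ) • Pi.single k 1 := by
    ext l
    rcases eq_or_ne l i with rfl | hli
    · simp [hij]
    rcases eq_or_ne l j with rfl | hlj
    · simp [hli]
    simp [hli, hlj, hxs l hli hlj]
  rw [e]
  exact h.map_eq_self (convex_stdSimplex ℝ ι) hG (hx.1 i) (hx.1 j) le_rfl (by rw [add_zero, hsum])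

/-- A betweenness preserving self-map of a simplex of dimension at least two that fixes the vertices
and the barycenter is the identity. -/
theorem PreservesBetweennessOn.map_eq_self (hG : PreservesBetweennessOn G (stdSimplex ℝ ι))
    (hcard : 3 ≤ Fintype.card ι) (hvert : ∀ i, G (Pi.single i 1) = Pi.single i 1)
    (hbary : G (fun _ => (Fintype.card ι : ℝ)⁻¹) = fun _ => (Fintype.card ι : ℝ)⁻¹)
    {x : ι → ℝ} (hx : x ∈ stdSimplex ℝ ι) : G x = x := by
  have key : ∀ (n : ℕ) (s : Finset ι), s.card = n → ∀ x ∈ stdSimplex ℝ ι, (∀ i, i ∉ s → x i = 0) →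
      G x = x := by
    intro n
    induction n with
    | zero =>
      intro s hs x hx h
      obtain rfl := Finset.card_eq_zero.1 hs
      have := hx.2
      simp [h] at this
    | succ n ih =>
      intro s hs x hx h
      by_cases hzero : ∃ i ∈ s, x i = 0
      · obtain ⟨i, his, hi⟩ := hzero
        refine ih (s.erase i) (by rw [Finset.card_erase_of_mem his, hs]; rfl) x hx fun j hj => ?_
        rcases eq_or_ne j i with rfl | hji
        · exact hi
        · exact h j fun hjs => hj (Finset.mem_erase.2 ⟨hji, hjs⟩)
      push Not at hzero
      have hpos : ∀ i ∈ s, 0 < x i := fun i hi => lt_of_le_of_ne (hx.1 i) (hzero i hi).symm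
      by_cases hvertex : ∃ i, x i = 1
      · obtain ⟨i, hi⟩ := hvertex
        rw [eq_single_of_mem_stdSimplex hx hi, hvert]
      push Not at hvertex
      rcases le_or_gt s.card 2 with hs2 | hs2
      · rcases Nat.lt_or_ge s.card 2 with hs1 | hs1
        · obtain ⟨i, rfl⟩ := Finset.card_eq_one.1 (show s.card = 1 by omega)
          have hsum := hx.2
          rw [Fintype.sum_eq_single i (fun j hj => h j (by simpa using hj))] at hsum
          exact absurd hsum (hvertex i)
        · obtain ⟨i, j, hij, rfl⟩ := Finset.card_eq_two.1 (show s.card = 2 by omega)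
          exact hG.map_eq_self_of_edge hcard hvert hbary hij hx fun l hli hlj =>
            h l (by simp [hli, hlj])
      -- The projection `y` of `x` from the vertex `i` to the opposite face is fixed by induction,
      -- and `G x` lies between that vertex and `y`. So away from `i` the coordinates of `G x` are
      -- proportional to those of `x`.
      have hratio : ∀ i ∈ s, ∀ k l, k ≠ i → l ≠ i → G x k * x l = G x l * x k := by
        intro i his k l hk hl
        obtain ⟨y, hy, hyi, hyj, hxy⟩ := exists_mem_opposite_face hx (hvertex i)
        have h1 := mem_Icc_of_mem_stdSimplex hx i
        have hpos' : 0 < 1 - x i := sub_pos.2 (lt_of_le_of_ne h1.2 (hvertex i))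
        have hGy : G y = y := by
          refine ih (s.erase i) (by rw [Finset.card_erase_of_mem his, hs]; rfl) y hy fun j hj => ?_
          rcases eq_or_ne j i with rfl | hji
          · exact hyi
          · have := hyj j hji
            rw [h j fun hjs => hj (Finset.mem_erase.2 ⟨hji, hjs⟩)] at this
            exact (mul_eq_zero.1 this).resolve_left hpos'.ne'
        obtain ⟨a, b, -, -, -, e⟩ := wbtw_iff_exists_eq_add.1
          (hG _ (single_mem_stdSimplex ℝ i) _ hx _ hy
            (wbtw_iff_exists_eq_add.2 ⟨x i, 1 - x i, h1.1, hpos'.le, by ring, hxy⟩))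
        rw [hGy, hvert] at e
        have ek : G x k = b * y k := by rw [e]; simp [hk]
        have el : G x l = b * y l := by rw [e]; simp [hl]
        rw [ek, el, ← hyj k hk, ← hyj l hl]
        ring
      obtain ⟨i, j, k, hi, hj, hk, hij, hik, hjk⟩ := Finset.two_lt_card_iff.1 hs2
      -- Projections from two vertices `i` and `j`, compared through a third index `k`, give
      -- proportionality of all coordinates; the sums then force equality.
      have hall : ∀ l, G x l * x k = G x k * x l := by
        intro l
        rcases eq_or_ne l i with rfl | hl
        · exact hratio j hj l k hij hjk.symm
        · exact hratio i hi l k hl hik.symm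
      have hkk : G x k = x k := by
        have hs := Finset.sum_congr rfl fun l (_ : l ∈ Finset.univ) => hall l
        rw [← Finset.sum_mul, ← Finset.mul_sum, hx.2, (hG.mapsTo_stdSimplex hvert hx).2] at hs
        linarith
      ext l
      have := hall l
      rw [hkk, mul_comm (x k)] at this
      exact mul_right_cancel₀ (hpos k hk).ne' this
  exact key _ Finset.univ rfl x hx (by simp)

end Identity

/-! ### Projective normalization by weights -/

section Weights

variable {ι : Type*} [Fintype ι] {V : Type*} [AddCommGroup V] [Module ℝ V]

theorem AffineIndependent.eq_of_sum_smul_eq {q : ι → V} (hq : AffineIndependent ℝ q)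
    {x y : ι → ℝ} (hs : ∑ i, x i = ∑ i, y i) (h : ∑ i, x i • q i = ∑ i, y i • q i) : x = y := by
  have := affineIndependent_iff.1 hq Finset.univ (x - y)
    (by simp [Finset.sum_sub_distrib, hs]) (by simp [sub_smul, Finset.sum_sub_distrib, h])
  ext i
  exact sub_eq_zero.1 (this i (Finset.mem_univ i))

theorem sum_div_pos {c : ι → ℝ} (hc : ∀ i, 0 < c i) {z : ι → ℝ} (hz : z ∈ stdSimplex ℝ ι) :
    0 < ∑ i, z i / c i := by
  refine lt_of_le_of_ne (Finset.sum_nonneg fun i _ => div_nonneg (hz.1 i) (hc i).le) fun h => ?_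
  have h' := (Finset.sum_eq_zero_iff_of_nonneg
    fun i _ => div_nonneg (hz.1 i) (hc i).le).1 h.symm
  have h0 : ∀ i, z i = 0 := fun i =>
    (div_eq_zero_iff.1 (h' i (Finset.mem_univ i))).resolve_right (hc i).ne'
  have := hz.2
  simp [h0] at this

/-- The projective self-map of the standard simplex that divides the coordinates by weights `c`. -/
noncomputable def divideByWeights (c : ι → ℝ) (z : ι → ℝ) : ι → ℝ :=
  (∑ i, z i / c i)⁻¹ • fun i => z i / c i

theorem divideByWeights_mem {c : ι → ℝ} (hc : ∀ i, 0 < c i) {z : ι → ℝ}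
    (hz : z ∈ stdSimplex ℝ ι) : divideByWeights c z ∈ stdSimplex ℝ ι := by
  have h := sum_div_pos hc hz
  refine ⟨fun i => mul_nonneg (inv_nonneg.2 h.le) (div_nonneg (hz.1 i) (hc i).le), ?_⟩
  simp only [divideByWeights, Pi.smul_apply, smul_eq_mul, ← Finset.mul_sum]
  exact inv_mul_cancel₀ h.ne'

/-- The denominator is linear and positive on the simplex, so a convex combination goes to a convex
combination whose coefficients are rescaled by the denominators. -/
theorem wbtw_divideByWeights {c : ι → ℝ} (hc : ∀ i, 0 < c i) {a x b : ι → ℝ}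
    (ha : a ∈ stdSimplex ℝ ι) (hx : x ∈ stdSimplex ℝ ι) (hb : b ∈ stdSimplex ℝ ι)
    (h : Wbtw ℝ a x b) :
    Wbtw ℝ (divideByWeights c a) (divideByWeights c x) (divideByWeights c b) := by
  obtain ⟨s, t, hs, ht, hst, e⟩ := wbtw_iff_exists_eq_add.1 h
  have hA := sum_div_pos hc ha
  have hX := sum_div_pos hc hx
  have hB := sum_div_pos hc hb
  have hsum : ∑ i, x i / c i = s * ∑ i, a i / c i + t * ∑ i, b i / c i := by
    rw [Finset.mul_sum, Finset.mul_sum, ← Finset.sum_add_distrib]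
    refine Finset.sum_congr rfl fun i _ => ?_
    rw [e]
    simp only [Pi.add_apply, Pi.smul_apply, smul_eq_mul]
    ring
  refine wbtw_iff_exists_eq_add.2 ⟨s * (∑ i, a i / c i) / ∑ i, x i / c i,
    t * (∑ i, b i / c i) / ∑ i, x i / c i, by positivity, by positivity, ?_, ?_⟩
  · rw [← add_div, ← hsum, div_self hX.ne']
  · ext j
    have ej : x j = s * a j + t * b j := by simp [e]
    have hj := (hc j).ne'
    have hA' := hA.ne'
    have hX' := hX.ne'
    have hB' := hB.ne'
    simp only [divideByWeights, Pi.add_apply, Pi.smul_apply, smul_eq_mul]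
    generalize (∑ i, a i / c i) = A at *
    generalize (∑ i, b i / c i) = B at *
    generalize (∑ i, x i / c i) = X at *
    rw [ej]
    field_simp

variable [DecidableEq ι]

theorem exists_mem_stdSimplex_of_mem_convexHull_image {q : ι → V} {s : Set ι} {z : V}
    (hz : z ∈ convexHull ℝ (q '' s)) :
    ∃ t ∈ stdSimplex ℝ ι, z = ∑ i, t i • q i ∧ ∀ i, i ∉ s → t i = 0 := by
  have e : q '' s = Fintype.linearCombination ℝ q ''
      ((fun i : ι => (Pi.single i 1 : ι → ℝ)) '' s) := by
    rw [Set.image_image]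
    exact Set.image_congr fun i _ => by simp
  rw [e, ← LinearMap.image_convexHull] at hz
  obtain ⟨t, ht, rfl⟩ := hz
  refine ⟨t, ?_, by simp [Fintype.linearCombination_apply],
    fun i hi => eq_zero_of_mem_convexHull_single ht hi⟩
  rw [← convexHull_rangle_single_eq_stdSimplex]
  exact convexHull_mono (Set.image_subset_range _ _) ht

/-- An injective betweenness preserving map that sends the vertices of a simplex of dimension at least
two to affinely independent points is projective. -/
theorem PreservesBetweennessOn.exists_weights {f : (ι → ℝ) → V}
    (hf : PreservesBetweennessOn f (stdSimplex ℝ ι)) (hinj : Set.InjOn f (stdSimplex ℝ ι))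
    (hcard : 3 ≤ Fintype.card ι) (hq : AffineIndependent ℝ fun i => f (Pi.single i 1)) :
    ∃ w : ι → ℝ, (∀ i, 0 < w i) ∧ ∀ x ∈ stdSimplex ℝ ι,
      (∑ i, w i * x i) • f x = ∑ i, (w i * x i) • f (Pi.single i 1) := by
  have hne : Nonempty ι := Fintype.card_pos_iff.1 (by omega)
  -- `F` will be `f` in the barycentric coordinates of the image vertices; its value off the simplex
  -- is irrelevant.
  have hex : ∀ x : ι → ℝ, ∃ z : ι → ℝ, x ∈ stdSimplex ℝ ι →
      z ∈ stdSimplex ℝ ι ∧ f x = ∑ i, z i • f (Pi.single i 1) := by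
    intro x
    by_cases hx : x ∈ stdSimplex ℝ ι
    · obtain ⟨t, ht, h, -⟩ := exists_mem_stdSimplex_of_mem_convexHull_image
        (hf.mem_convexHull_image Finset.univ x hx (by simp))
      exact ⟨t, fun _ => ⟨ht, h⟩⟩
    · exact ⟨0, fun h => absurd h hx⟩
  choose F hF using hex
  have hFK : ∀ x ∈ stdSimplex ℝ ι, F x ∈ stdSimplex ℝ ι := fun x hx => (hF x hx).1
  have hFb : PreservesBetweennessOn F (stdSimplex ℝ ι) := by
    intro a ha x hx b hb h
    obtain ⟨s, t, hs, ht, hst, e⟩ := wbtw_iff_exists_eq_add.1 (hf a ha x hx b hb h)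
    refine wbtw_iff_exists_eq_add.2 ⟨s, t, hs, ht, hst, hq.eq_of_sum_smul_eq ?_ ?_⟩
    · simp only [Pi.add_apply, Pi.smul_apply, smul_eq_mul, Finset.sum_add_distrib,
        ← Finset.mul_sum, (hFK a ha).2, (hFK x hx).2, (hFK b hb).2]
      linarith
    · rw [← (hF x hx).2, e, (hF a ha).2, (hF b hb).2]
      simp only [Pi.add_apply, Pi.smul_apply, smul_eq_mul, add_smul, mul_smul,
        Finset.sum_add_distrib, ← Finset.smul_sum]
  have hFv : ∀ i, F (Pi.single i 1) = Pi.single i 1 := by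
    intro i
    have hi := single_mem_stdSimplex ℝ i
    refine hq.eq_of_sum_smul_eq ((hFK _ hi).2.trans hi.2.symm) ?_
    rw [← (hF _ hi).2, Fintype.sum_eq_single i fun j hj => by simp [hj]]
    simp
  have hFinj : ∀ x ∈ stdSimplex ℝ ι, ∀ y ∈ stdSimplex ℝ ι, F x = F y → x = y := by
    intro x hx y hy h
    exact hinj hx hy (by rw [(hF x hx).2, (hF y hy).2, h])
  set u : ι → ℝ := fun _ => (Fintype.card ι : ℝ)⁻¹ with hu
  have huK : u ∈ stdSimplex ℝ ι := const_mem_stdSimplex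
  set c := F u with hc
  have hcpos : ∀ i, 0 < c i := by
    intro i
    have hui : u i ≠ 1 := by
      have : (3 : ℝ) ≤ Fintype.card ι := by exact_mod_cast hcard
      intro h
      rw [hu, inv_eq_one] at h
      linarith
    -- If `c i = 0`, the image of the barycenter, lying between the vertex `i` and the image of a
    -- point `y` of the opposite face, equals that image, against injectivity.
    refine lt_of_le_of_ne ((hFK u huK).1 i) fun h0 => ?_
    obtain ⟨y, hy, hyi, -, huy⟩ := exists_mem_opposite_face huK hui
    have hI := mem_Icc_of_mem_stdSimplex huK i
    obtain ⟨s, t, -, -, hst, e⟩ := wbtw_iff_exists_eq_add.1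
      (hFb _ (single_mem_stdSimplex ℝ i) _ huK _ hy
        (wbtw_iff_exists_eq_add.2 ⟨u i, 1 - u i, hI.1, sub_nonneg.2 hI.2, by ring, huy⟩))
    have hs : s = 0 := by
      have := congrFun e i
      rw [← hc, ← h0, hFv] at this
      simpa [hFb.apply_eq_zero hFv hy hyi] using this.symm
    subst hs
    obtain rfl : t = 1 := by linarith
    rw [zero_smul, one_smul, zero_add] at e
    have := congrFun (hFinj u huK y hy e) i
    rw [hyi] at this
    have : (Fintype.card ι : ℝ)⁻¹ = 0 := this
    rw [inv_eq_zero, Nat.cast_eq_zero] at this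
    omega
  have hGb : PreservesBetweennessOn (fun x => divideByWeights c (F x)) (stdSimplex ℝ ι) :=
    fun a ha x hx b hb h => wbtw_divideByWeights hcpos (hFK a ha) (hFK x hx) (hFK b hb)
      (hFb a ha x hx b hb h)
  have hGv : ∀ i, divideByWeights c (F (Pi.single i 1)) = Pi.single i 1 := by
    intro i
    rw [hFv]
    have hsum : ∑ j, (Pi.single i 1 : ι → ℝ) j / c j = (c i)⁻¹ := by
      rw [Fintype.sum_eq_single i fun j hj => by simp [hj]]
      simp
    ext j
    simp only [divideByWeights, hsum, inv_inv, Pi.smul_apply, smul_eq_mul]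
    rcases eq_or_ne j i with rfl | hj
    · simp [(hcpos j).ne']
    · simp [hj]
  have hGu : divideByWeights c (F u) = u := by
    rw [← hc]
    ext j
    simp [divideByWeights, hu, div_self (hcpos _).ne']
  refine ⟨c, hcpos, fun x hx => ?_⟩
  have hGx := hGb.map_eq_self hcard hGv hGu hx
  have hS := sum_div_pos hcpos (hFK x hx)
  set S := ∑ i, F x i / c i with hSdef
  have hFx : ∀ i, F x i = S * (c i * x i) := by
    intro i
    have h := congrFun hGx i
    simp only [divideByWeights, Pi.smul_apply, smul_eq_mul, ← hSdef] at h
    rw [← h]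
    have := (hcpos i).ne'
    field_simp
  have hsum : S * ∑ i, c i * x i = 1 := by
    rw [Finset.mul_sum, ← (hFK x hx).2]
    exact Finset.sum_congr rfl fun i _ => (hFx i).symm
  rw [(hF x hx).2]
  simp only [hFx, mul_smul S, ← Finset.smul_sum]
  rw [smul_smul, mul_comm, hsum, one_smul]

/-- Dividing by the weights inverts the projective formula, so `f` is onto the hull of the image
vertices. The control of zero coordinates keeps the preimage in the corresponding face. -/
theorem exists_apply_eq_sum_smul {f : (ι → ℝ) → V} {w : ι → ℝ} (hw : ∀ i, 0 < w i)
    (hf : ∀ x ∈ stdSimplex ℝ ι,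
      (∑ i, w i * x i) • f x = ∑ i, (w i * x i) • f (Pi.single i 1))
    {t : ι → ℝ} (ht : t ∈ stdSimplex ℝ ι) :
    ∃ x ∈ stdSimplex ℝ ι, f x = ∑ i, t i • f (Pi.single i 1) ∧ ∀ i, t i = 0 → x i = 0 := by
  refine ⟨divideByWeights w t, divideByWeights_mem hw ht, ?_, fun i hi => ?_⟩
  · have h := hf _ (divideByWeights_mem hw ht)
    have hpos := sum_div_pos hw ht
    set S := ∑ i, t i / w i with hS
    have e : ∀ i, w i * divideByWeights w t i = S⁻¹ * t i := by
      intro i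
      simp only [divideByWeights, Pi.smul_apply, smul_eq_mul, ← hS]
      have := (hw i).ne'
      field_simp
    simp only [e, ← Finset.mul_sum, ht.2, mul_one, mul_smul, ← Finset.smul_sum] at h
    exact smul_right_injective V (inv_ne_zero hpos.ne') h
  · simp [divideByWeights, hi]

end Weights

/-! ### Affine independence of the image vertices -/

section Nondegeneracy

variable {V : Type*} [AddCommGroup V] [Module ℝ V]

/-- The linear map that sends the vertices of a simplex to vertices of another one. -/
noncomputable def vertexMap {κ ι : Type*} [Fintype κ] [DecidableEq ι] (σ : κ → ι) :
    (κ → ℝ) →ₗ[ℝ] (ι → ℝ) :=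
  Fintype.linearCombination ℝ fun k => Pi.single (σ k) 1

section VertexMap

variable {κ ι : Type*} [Fintype κ] [DecidableEq ι] {σ : κ → ι}

theorem vertexMap_single [DecidableEq κ] (k : κ) :
    vertexMap σ (Pi.single k 1) = Pi.single (σ k) 1 := by
  simp [vertexMap]

theorem vertexMap_mem [Fintype ι] {x : κ → ℝ} (hx : x ∈ stdSimplex ℝ κ) :
    vertexMap σ x ∈ stdSimplex ℝ ι := by
  rw [vertexMap, Fintype.linearCombination_apply]
  exact (convex_stdSimplex ℝ ι).sum_mem (fun i _ => hx.1 i) hx.2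
    fun k _ => single_mem_stdSimplex ℝ (σ k)

theorem vertexMap_apply_apply (hσ : Function.Injective σ) (x : κ → ℝ) (k : κ) :
    vertexMap σ x (σ k) = x k := by
  rw [vertexMap, Fintype.linearCombination_apply, Finset.sum_apply,
    Fintype.sum_eq_single k fun j hj => by simp [hσ.ne hj.symm]]
  simp

theorem vertexMap_apply_of_notMem (x : κ → ℝ) {i : ι} (hi : i ∉ Set.range σ) :
    vertexMap σ x i = 0 := by
  rw [vertexMap, Fintype.linearCombination_apply, Finset.sum_apply]
  refine Finset.sum_eq_zero fun k _ => ?_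
  have : i ≠ σ k := by rintro rfl; exact hi ⟨k, rfl⟩
  simp [this]

theorem PreservesBetweennessOn.comp_vertexMap [Fintype ι] {f : (ι → ℝ) → V}
    (hf : PreservesBetweennessOn f (stdSimplex ℝ ι)) :
    PreservesBetweennessOn (fun x => f (vertexMap σ x)) (stdSimplex ℝ κ) := by
  intro a ha x hx b hb h
  exact hf _ (vertexMap_mem ha) _ (vertexMap_mem hx) _ (vertexMap_mem hb)
    (h.map (vertexMap σ).toAffineMap)

theorem injOn_comp_vertexMap [Fintype ι] {V : Type*} (hσ : Function.Injective σ) {f : (ι → ℝ) → V}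
    (hf : Set.InjOn f (stdSimplex ℝ ι)) :
    Set.InjOn (fun x => f (vertexMap σ x)) (stdSimplex ℝ κ) := by
  intro x hx y hy h
  have := hf (vertexMap_mem hx) (vertexMap_mem hy) h
  ext k
  rw [← vertexMap_apply_apply hσ x, this, vertexMap_apply_apply hσ]

end VertexMap

/-- If the three images were collinear, the whole image would lie on a line, and a coordinate on it
would be an injective betweenness preserving real function on the triangle. -/
theorem PreservesBetweennessOn.affineIndependent_of_triangle {f : (Fin 3 → ℝ) → V}
    (hf : PreservesBetweennessOn f (stdSimplex ℝ (Fin 3)))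
    (hinj : Set.InjOn f (stdSimplex ℝ (Fin 3))) :
    AffineIndependent ℝ fun i => f (Pi.single i 1) := by
  rw [← not_not (a := AffineIndependent ℝ _), ← collinear_iff_not_affineIndependent]
  intro hcol
  obtain ⟨p₀, v, h⟩ := (collinear_iff_exists_forall_eq_smul_vadd _).1 hcol
  have hline : ∀ x : Fin 3 → ℝ, ∃ r : ℝ, x ∈ stdSimplex ℝ (Fin 3) → f x = r • v + p₀ := by
    intro x
    by_cases hx : x ∈ stdSimplex ℝ (Fin 3)
    · have hsub : convexHull ℝ ((fun i : Fin 3 => f (Pi.single i 1)) ''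
          ((Finset.univ : Finset (Fin 3)) : Set (Fin 3))) ⊆ {y | ∃ r : ℝ, y = r • v + p₀} := by
        refine convexHull_min ?_ ?_
        · rintro _ ⟨i, -, rfl⟩
          exact h _ ⟨i, rfl⟩
        · rintro _ ⟨r, rfl⟩ _ ⟨r', rfl⟩ a b _ _ hab
          refine ⟨a * r + b * r', ?_⟩
          obtain rfl : a = 1 - b := by linarith
          module
      obtain ⟨r, hr⟩ := hsub (hf.mem_convexHull_image Finset.univ x hx (by simp))
      exact ⟨r, fun _ => hr⟩
    · exact ⟨0, fun h => absurd h hx⟩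
  choose F hF using hline
  have hv : v ≠ 0 := by
    rintro rfl
    have h0 := single_mem_stdSimplex ℝ (0 : Fin 3)
    have h1 := single_mem_stdSimplex ℝ (1 : Fin 3)
    have := congrFun (hinj h0 h1 (by rw [hF _ h0, hF _ h1, smul_zero, smul_zero])) 0
    simp at this
  refine not_injOn_of_preservesBetweennessOn_triangle (F := F) ?_ ?_
  · intro a ha x hx b hb h
    obtain ⟨s, t, hs, ht, hst, e⟩ := wbtw_iff_exists_eq_add.1 (hf a ha x hx b hb h)
    refine wbtw_iff_exists_eq_add.2 ⟨s, t, hs, ht, hst, ?_⟩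
    rw [hF _ ha, hF _ hx, hF _ hb] at e
    refine smul_left_injective ℝ hv ?_
    obtain rfl : s = 1 - t := by linarith
    simp only [smul_eq_mul]
    rw [← eq_sub_iff_add_eq] at e
    rw [e]
    module
  · intro x hx y hy h
    exact hinj hx hy (by rw [hF _ hx, hF _ hy, h])

/-- An injective betweenness preserving map on a simplex of dimension at least two sends the vertices
to affinely independent points. -/
theorem PreservesBetweennessOn.affineIndependent {ι : Type*} [Fintype ι] [DecidableEq ι]
    {f : (ι → ℝ) → V} (hf : PreservesBetweennessOn f (stdSimplex ℝ ι))
    (hinj : Set.InjOn f (stdSimplex ℝ ι)) (hcard : 3 ≤ Fintype.card ι) :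
    AffineIndependent ℝ fun i => f (Pi.single i 1) := by
  obtain ⟨n, hn⟩ := Nat.exists_eq_add_of_le' hcard
  induction n generalizing ι with
  | zero =>
    have e : Fin 3 ≃ ι := (Fintype.equivFinOfCardEq (by simpa using hn)).symm
    have := (hf.comp_vertexMap (σ := e)).affineIndependent_of_triangle
      (injOn_comp_vertexMap e.injective hinj)
    simp only [vertexMap_single] at this
    exact (affineIndependent_equiv e (p := fun i => f (Pi.single i 1))).1 this
  | succ n ih =>
    by_contra hAI
    obtain ⟨I, z, hz, hz'⟩ := Convex.radon_partition hAI
    -- Omitting a vertex `i₀` outside `J` leaves a facet on which `f` is projective by induction,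
    -- hence onto; this gives a preimage of `z` supported in `J`.
    have key : ∀ J : Set ι, J ≠ Set.univ → z ∈ convexHull ℝ ((fun i => f (Pi.single i 1)) '' J) →
        ∃ x ∈ stdSimplex ℝ ι, f x = z ∧ ∀ i, i ∉ J → x i = 0 := by
      intro J hJ hzJ
      obtain ⟨i₀, hi₀⟩ := (Set.ne_univ_iff_exists_notMem J).1 hJ
      set σ : {i // i ≠ i₀} → ι := Subtype.val with hσ
      have hσi : Function.Injective σ := Subtype.val_injective
      have hcardκ : Fintype.card {i // i ≠ i₀} = n + 3 := by
        rw [Fintype.card_subtype_compl, Fintype.card_subtype_eq]; omega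
      have hf' := hf.comp_vertexMap (σ := σ)
      have hinj' := injOn_comp_vertexMap hσi hinj
      obtain ⟨w, hw, hwf⟩ := hf'.exists_weights hinj' (by omega)
        (ih hf' hinj' (by omega) hcardκ)
      have himg : (fun i => f (Pi.single i 1)) '' J =
          (fun k => f (Pi.single (σ k) 1)) '' (σ ⁻¹' J) := by
        ext y
        constructor
        · rintro ⟨i, hi, rfl⟩
          exact ⟨⟨i, by rintro rfl; exact hi₀ hi⟩, hi, rfl⟩
        · rintro ⟨k, hk, rfl⟩
          exact ⟨σ k, hk, rfl⟩
      rw [himg] at hzJ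
      obtain ⟨t, ht, hzt, hts⟩ := exists_mem_stdSimplex_of_mem_convexHull_image hzJ
      obtain ⟨x, hx, hfx, hxs⟩ := exists_apply_eq_sum_smul hw hwf ht
      simp only [vertexMap_single] at hfx
      refine ⟨vertexMap σ x, vertexMap_mem hx, hfx.trans hzt.symm, fun i hi => ?_⟩
      by_cases hii₀ : i = i₀
      · refine vertexMap_apply_of_notMem x ?_
        rintro ⟨k, rfl⟩
        exact k.2 hii₀
      · have := vertexMap_apply_apply hσi x ⟨i, hii₀⟩
        exact this.trans (hxs _ (hts _ hi))
    have hne : ∀ J : Set ι, z ∈ convexHull ℝ ((fun i => f (Pi.single i 1)) '' J) → J.Nonempty := by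
      intro J hJ
      exact (convexHull_nonempty_iff.1 ⟨z, hJ⟩).of_image
    obtain ⟨x, hx, hfx, hxI⟩ := key I (by
      rw [← Set.nonempty_compl]; exact hne _ hz') hz
    obtain ⟨y, hy, hfy, hyI⟩ := key Iᶜ (by
      rw [← Set.nonempty_compl, compl_compl]; exact hne _ hz) hz'
    obtain rfl := hinj hx hy (hfx.trans hfy.symm)
    have h0 : ∀ i, x i = 0 := fun i => by
      by_cases hi : i ∈ I
      · exact hyI i (by simpa using hi)
      · exact hxI i hi
    have := hx.2
    simp [h0] at this

end Nondegeneracy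

/-! ### From linear maps of homogeneous coordinates to homographies -/

section Homography

variable {E V : Type*} [AddCommGroup E] [Module ℝ E] [AddCommGroup V] [Module ℝ V]

theorem Projectivization.submodule_map {U W : Type*} [AddCommGroup U] [Module ℝ U] [AddCommGroup W]
    [Module ℝ W] (Φ : U →ₗ[ℝ] W) (hΦ : Function.Injective Φ) (x : ℙ ℝ U) :
    (Projectivization.map Φ hΦ x).submodule = x.submodule.map Φ := by
  induction x using Projectivization.ind with
  | h v hv =>
    rw [Projectivization.map_mk, Projectivization.submodule_mk, Projectivization.submodule_mk,
      Submodule.map_span, Set.image_singleton]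

theorem Projectivization.map_bijective {U W : Type*} [AddCommGroup U] [Module ℝ U] [AddCommGroup W]
    [Module ℝ W] (Φ : U ≃ₗ[ℝ] W) :
    Function.Bijective (Projectivization.map Φ.toLinearMap Φ.injective) := by
  refine ⟨Projectivization.map_injective Φ.toLinearMap Φ.injective, fun y => ?_⟩
  induction y using Projectivization.ind with
  | h v hv =>
    refine ⟨Projectivization.mk ℝ (Φ.symm v) (by simpa using hv), ?_⟩
    rw [Projectivization.map_mk]
    simp

/-- A linear isomorphism maps projective lines onto projective lines. -/
theorem IsProjectiveLine.image_map {U W : Type*} [AddCommGroup U] [Module ℝ U] [AddCommGroup W]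
    [Module ℝ W] (Φ : U ≃ₗ[ℝ] W) {l : Set (ℙ ℝ U)} (hl : IsProjectiveLine l) :
    IsProjectiveLine (Projectivization.map Φ.toLinearMap Φ.injective '' l) := by
  obtain ⟨M, hM, rfl⟩ := hl
  refine ⟨M.map Φ.toLinearMap, (LinearEquiv.finrank_map_eq Φ M).trans hM, ?_⟩
  have key : ∀ x : ℙ ℝ U, (Projectivization.map Φ.toLinearMap Φ.injective x).submodule ≤
      M.map Φ.toLinearMap ↔ x.submodule ≤ M := by
    intro x
    rw [Projectivization.submodule_map]
    exact Submodule.map_le_map_iff_of_injective Φ.injective _ _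
  ext y
  constructor
  · rintro ⟨x, hx, rfl⟩
    exact (key x).2 hx
  · intro hy
    obtain ⟨x, rfl⟩ := (Projectivization.map_bijective Φ).2 y
    exact ⟨x, (key x).1 hy, rfl⟩

/-- A linear map between the ambient spaces that restricts to an isomorphism of the homogenizations
induces a homography of the projective completions. -/
theorem exists_isHomography {A : AffineSubspace ℝ E} {B : AffineSubspace ℝ V}
    (L : E × ℝ →ₗ[ℝ] V × ℝ) (hmap : (homogenization A).map L = homogenization B)
    (hker : ∀ v ∈ homogenization A, L v = 0 → v = 0) :
    ∃ g : ProjectiveCompletion A → ProjectiveCompletion B, IsHomography g ∧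
      ∀ (x : E) (hx : x ∈ A) (y : V) (hy : y ∈ B) (c : ℝ), L (x, 1) = c • (y, 1) →
        g (toProjective A x hx) = toProjective B y hy := by
  have hL : ∀ v ∈ homogenization A, L v ∈ homogenization B := fun v hv =>
    hmap ▸ Submodule.mem_map_of_mem hv
  have hbij : Function.Bijective (L.restrict hL) := by
    constructor
    · rw [← LinearMap.ker_eq_bot, LinearMap.ker_eq_bot']
      intro v hv
      exact Subtype.ext (hker v v.2 (congrArg Subtype.val hv))
    · rintro ⟨y, hy⟩
      rw [← hmap] at hy
      obtain ⟨v, hv, rfl⟩ := hy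
      exact ⟨⟨v, hv⟩, rfl⟩
  set Φ := LinearEquiv.ofBijective (L.restrict hL) hbij with hΦ
  have hΦv : ∀ v : homogenization A, (Φ v : V × ℝ) = L v := fun v => rfl
  refine ⟨Projectivization.map Φ.toLinearMap Φ.injective,
    ⟨Projectivization.map_bijective Φ, fun l hl => hl.image_map Φ, ?_⟩, ?_⟩
  -- `T` and `d` are the two components of the affine map sending `x` to `L (x, 1)`.
  · let a : E →ᵃ[ℝ] E × ℝ := (AffineMap.id ℝ E).prod (AffineMap.const ℝ E 1)
    refine ⟨((LinearMap.fst ℝ V ℝ) ∘ₗ L).toAffineMap.comp a,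
      ((LinearMap.snd ℝ V ℝ) ∘ₗ L).toAffineMap.comp a, fun x hx => ?_⟩
    rw [toProjective, Projectivization.map_mk, Projectivization.submodule_mk, Submodule.map_span,
      Set.image_singleton]
    rfl
  · intro x hx y hy c h
    rw [toProjective, toProjective, Projectivization.map_mk, Projectivization.mk_eq_mk_iff']
    exact ⟨c, Subtype.ext h.symm⟩

variable {ι : Type*} [Fintype ι]

theorem homogenization_affineSpan_range (p : ι → E) :
    homogenization (affineSpan ℝ (Set.range p)) =
      Submodule.span ℝ (Set.range fun i => (p i, (1 : ℝ))) := by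
  refine le_antisymm (Submodule.span_le.2 ?_) (Submodule.span_le.2 ?_)
  · rintro _ ⟨x, hx, rfl⟩
    obtain ⟨w, hw, rfl⟩ := eq_affineCombination_of_mem_affineSpan_of_fintype hx
    rw [Finset.affineCombination_eq_linear_combination _ _ _ hw]
    refine (Submodule.mem_span_range_iff_exists_fun ℝ).2 ⟨w, ?_⟩
    ext
    · simp [Prod.fst_sum]
    · simpa [Prod.snd_sum] using hw
  · rintro _ ⟨i, rfl⟩
    exact Submodule.subset_span ⟨p i, subset_affineSpan ℝ _ ⟨i, rfl⟩, rfl⟩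

theorem AffineIndependent.linearIndependent_prod_one {p : ι → E} (hp : AffineIndependent ℝ p) :
    LinearIndependent ℝ fun i => (p i, (1 : ℝ)) := by
  rw [Fintype.linearIndependent_iff]
  intro c hc i
  have h1 := congrArg Prod.fst hc
  have h2 := congrArg Prod.snd hc
  simp only [Prod.smul_mk, Prod.fst_sum, Prod.snd_sum, smul_eq_mul, mul_one, Prod.fst_zero,
    Prod.snd_zero] at h1 h2
  exact affineIndependent_iff.1 hp Finset.univ c h2 h1 i (Finset.mem_univ i)

/-- Affine independence makes the vectors `(p i, 1)` a basis of the homogenization, so the images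
can be prescribed with arbitrary nonzero weights. The map is then extended to all of `E × ℝ`, since
a projective transformation needs `T` and `d` on the whole of `E`. -/
theorem exists_linearMap_of_affineIndependent {p : ι → E} {q : ι → V}
    (hp : AffineIndependent ℝ p) (hq : AffineIndependent ℝ q) {w : ι → ℝ} (hw : ∀ i, w i ≠ 0) :
    ∃ L : E × ℝ →ₗ[ℝ] V × ℝ, (∀ i, L (p i, 1) = w i • (q i, 1)) ∧
      (homogenization (affineSpan ℝ (Set.range p))).map L =
        homogenization (affineSpan ℝ (Set.range q)) ∧
      ∀ v ∈ homogenization (affineSpan ℝ (Set.range p)), L v = 0 → v = 0 := by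
  have hP := hp.linearIndependent_prod_one
  have hQ := hq.linearIndependent_prod_one
  obtain ⟨L, hL⟩ := LinearMap.exists_extend
    ((Module.Basis.span hP).constr ℝ fun i => w i • (q i, (1 : ℝ)))
  have hLi : ∀ i, L (p i, 1) = w i • (q i, 1) := by
    intro i
    have h := LinearMap.congr_fun hL (Module.Basis.span hP i)
    rw [Module.Basis.constr_basis] at h
    simpa [Module.Basis.span_apply] using h
  refine ⟨L, hLi, ?_, ?_⟩
  · rw [homogenization_affineSpan_range, homogenization_affineSpan_range, Submodule.map_span,
      ← Set.range_comp]
    refine le_antisymm (Submodule.span_le.2 ?_) (Submodule.span_le.2 ?_)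
    · rintro _ ⟨i, rfl⟩
      rw [Function.comp_apply, hLi]
      exact Submodule.smul_mem _ _ (Submodule.subset_span ⟨i, rfl⟩)
    · rintro _ ⟨i, rfl⟩
      have h : (q i, (1 : ℝ)) = (w i)⁻¹ • L (p i, 1) := by rw [hLi, inv_smul_smul₀ (hw i)]
      show (q i, (1 : ℝ)) ∈ _
      rw [h]
      exact Submodule.smul_mem _ _ (Submodule.subset_span ⟨i, rfl⟩)
  · intro v hv h0
    rw [homogenization_affineSpan_range, Submodule.mem_span_range_iff_exists_fun] at hv
    obtain ⟨c, rfl⟩ := hv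
    simp only [map_sum, map_smul, hLi, smul_smul] at h0
    have hc := Fintype.linearIndependent_iff.1 hQ (fun i => c i * w i) h0
    refine Finset.sum_eq_zero fun i _ => ?_
    rw [(mul_eq_zero.1 (hc i)).resolve_right (hw i), zero_smul]

end Homography

/-! ### The main theorem -/

theorem mainTheorem4 {E V : Type*} [AddCommGroup E] [Module ℝ E] [AddCommGroup V] [Module ℝ V]
    (m : ℕ) (hm : 2 ≤ m) (Δ : Set E) (hΔ : IsSimplex m Δ)
    (f : Δ → V) (hinj : Function.Injective f) (hmono : IsMonotoneMap f) :
    IsSimplex m (Set.range f) ∧ IsPartialHomography f := by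
  classical
  obtain ⟨p, hp, hΔp⟩ := hΔ
  have hmem : ∀ x ∈ stdSimplex ℝ (Fin (m + 1)), Fintype.linearCombination ℝ p x ∈ Δ := by
    intro x hx
    rw [hΔp, Fintype.linearCombination_apply]
    exact (convex_convexHull ℝ _).sum_mem (fun i _ => hx.1 i) hx.2
      fun i _ => subset_convexHull ℝ _ (Set.mem_range_self i)
  -- `f` in barycentric coordinates, made total by the default value `0`, which is never used on the
  -- standard simplex.
  set F : (Fin (m + 1) → ℝ) → V := fun x =>
    if h : Fintype.linearCombination ℝ p x ∈ Δ then f ⟨_, h⟩ else 0 with hF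
  have hFx : ∀ x (hx : x ∈ stdSimplex ℝ (Fin (m + 1))), F x = f ⟨_, hmem x hx⟩ := fun x hx =>
    dif_pos (hmem x hx)
  have hFb : PreservesBetweennessOn F (stdSimplex ℝ (Fin (m + 1))) := by
    intro a ha x hx b hb h
    rw [hFx a ha, hFx x hx, hFx b hb]
    exact hmono _ _ _ (h.map (Fintype.linearCombination ℝ p).toAffineMap)
  have hFi : Set.InjOn F (stdSimplex ℝ (Fin (m + 1))) := by
    intro x hx y hy h
    rw [hFx x hx, hFx y hy] at h
    have := congrArg Subtype.val (hinj h)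
    simp only [Fintype.linearCombination_apply] at this
    exact hp.eq_of_sum_smul_eq (hx.2.trans hy.2.symm) this
  have hsurj : ∀ z : Δ, ∃ x, ∃ hx : x ∈ stdSimplex ℝ (Fin (m + 1)), z = ⟨_, hmem x hx⟩ := by
    rintro ⟨z, hz⟩
    have hz' := hz
    rw [hΔp, ← Set.image_univ] at hz'
    obtain ⟨x, hx, rfl, -⟩ := exists_mem_stdSimplex_of_mem_convexHull_image hz'
    exact ⟨x, hx, Subtype.ext (by simp [Fintype.linearCombination_apply])⟩
  have hcard : 3 ≤ Fintype.card (Fin (m + 1)) := by rw [Fintype.card_fin]; omega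
  set q : Fin (m + 1) → V := fun i => F (Pi.single i 1) with hq
  have hqi : AffineIndependent ℝ q := hFb.affineIndependent hFi hcard
  obtain ⟨w, hw, hwF⟩ := hFb.exists_weights hFi hcard hqi
  have hrange : Set.range f = convexHull ℝ (Set.range q) := by
    refine Set.Subset.antisymm ?_ ?_
    · rintro _ ⟨z, rfl⟩
      obtain ⟨x, hx, rfl⟩ := hsurj z
      have := hFb.mem_convexHull_image Finset.univ x hx (by simp)
      rwa [hFx x hx, Finset.coe_univ, Set.image_univ] at this
    · intro y hy
      rw [← Set.image_univ] at hy
      obtain ⟨t, ht, rfl, -⟩ := exists_mem_stdSimplex_of_mem_convexHull_image hy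
      obtain ⟨x, hx, hxt, -⟩ := exists_apply_eq_sum_smul hw hwF ht
      exact ⟨⟨_, hmem x hx⟩, (hFx x hx).symm.trans hxt⟩
  refine ⟨⟨q, hqi, hrange⟩, ?_⟩
  obtain ⟨L, hL, hmap, hker⟩ := exists_linearMap_of_affineIndependent hp hqi fun i => (hw i).ne'
  have hA : affineSpan ℝ Δ = affineSpan ℝ (Set.range p) := by rw [hΔp, affineSpan_convexHull]
  have hB : affineSpan ℝ (Set.range f) = affineSpan ℝ (Set.range q) := by
    rw [hrange, affineSpan_convexHull]
  rw [← hA, ← hB] at hmap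
  rw [← hA] at hker
  obtain ⟨g, hg, hgf⟩ := exists_isHomography L hmap hker
  refine ⟨g, hg, fun z => ?_⟩
  obtain ⟨x, hx, rfl⟩ := hsurj z
  -- The scalar is the denominator of the projective formula: `L` sends the lift of the point to
  -- this multiple of the lift of its image.
  refine hgf _ _ _ _ (∑ i, w i * x i) ?_
  have e : (Fintype.linearCombination ℝ p x, (1 : ℝ)) = ∑ i, x i • (p i, (1 : ℝ)) := by
    ext
    · simp [Fintype.linearCombination_apply, Prod.fst_sum]
    · simpa [Prod.snd_sum] using hx.2.symm
  have h := hwF x hx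
  rw [hFx x hx] at h
  rw [e, map_sum, Prod.smul_mk, h]
  simp only [map_smul, hL, smul_smul]
  ext
  · simp [Prod.fst_sum, hq, mul_comm]
  · simp [Prod.snd_sum, mul_comm]
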